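/- Let $\mathcal H$ be a complex Hilbert space (inner product linear in the second argument) and let $S$ be a strictly positive symmetric operator on $\mathcal H$, i.e. $S$ is densely defined, symmetric, and there is $\varepsilon>0$ with $\langle f,Sf\rangle\ge\varepsilon\|f\|^2$ for all $f\in\mathcal D(S)$. Let $S_F$ be its Friedrichs extension: the restriction of $S^*$ to those $f\in\mathcal D(S^*)$ for which there are $f_n\in\mathcal D(S)$ with $f_n\to f$ and $\langle f_n-f_m,S(f_n-f_m)\rangle\to0$ as $n,m\to\infty$. Let $S_K$ be its Kreĭn–von Neumann extension: the restriction of $S^*$ to $\mathcal D(\overline S)\dot+\ker S^*$. Then $S_F$ is a strictly positive selfadjoint extension of $S$ and $S_K$ is non-negative and selfadjoint, so that the non-negative selfadjoint square roots $S_F^{1/2}$ and $S_K^{1/2}$ exist. Put $A=iS$. Then $A$ is dissipative (densely defined with $\operatorname{Im}\langle f,Af\rangle\ge0$ for $f\in\mathcal D(A)$), and the quadratic form $q_A(f)=\operatorname{Im}\langle f,Af\rangle$, $\mathcal D(q_A)=\mathcal D(A)$, is closable. Let $V_A$ be the non-negative selfadjoint operator associated with the closure of $q_A$. Then $$V_A=S_F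 .$$ Let $W_A$ be the operator with domain $\mathcal D(W_A)=\operatorname{ran}(V_A^{1/2}\upharpoonright_{\mathcal D(A)})$ and $W_Ag=AV_A^{-1/2}g$. It is densely defined, and its adjoint $W_A^*$ is given by $$\mathcal D(W_A^*)=\mathcal D(S_K^{1/2})=\mathcal D(S_F^{1/2})\dot+\ker S^*,\qquad W_A^*f=-iS_F^{1/2}\mathcal Pf,$$ where the sum is direct ($\mathcal D(S_F^{1/2})\cap\ker S^*=\{0\}$) and $\mathcal P$ is the projection onto $\mathcal D(S_F^{1/2})$ along $\ker S^*$, defined on $\mathcal D(S_F^{1/2})\dot+\ker S^*$. In particular, every accretive extension $B$ of $S$ (an extension such that $iB$ is dissipative) satisfies $\mathcal D(B)\subset\mathcal D(S_K^{1/2})$. -/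

import Mathlib

open Filter Topology ComplexConjugate

noncomputable section

/-- A non-negative (Hermitian) form on a subspace of a complex inner product space `H`,
conjugate-linear in the first and linear in the second argument. -/
structure NonnegForm (H : Type*) [NormedAddCommGroup H] [InnerProductSpace ℂ H] where
  /-- the domain of the form -/
  domain : Submodule ℂ H
  /-- the sesquilinear form -/
  form : domain →ₗ⋆[ℂ] domain →ₗ[ℂ] ℂ
  hermitian : ∀ f g, conj (form f g) = form g f
  nonneg : ∀ f, 0 ≤ (form f f).re

namespace NonnegForm

variable {H : Type*} [NormedAddCommGroup H] [InnerProductSpace ℂ H]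

/-- The quadratic form `q(f) = q(f, f)`. -/
def quad (q : NonnegForm H) (f : q.domain) : ℝ := (q.form f f).re

/-- `u n → f` in `H` and `q (u n - u m) → 0` as `n, m → ∞`. -/
def Approx (q : NonnegForm H) (u : ℕ → q.domain) (f : H) : Prop :=
  Tendsto (fun n => (u n : H)) atTop (𝓝 f) ∧
    Tendsto (fun p : ℕ × ℕ => q.quad (u p.1 - u p.2)) atTop (𝓝 0)

/-- The form `q` is closable: if `u n → 0` in `H` and `q (u n - u m) → 0`, then `q (u n) → 0`. -/
def IsClosable (q : NonnegForm H) : Prop :=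
  ∀ u : ℕ → q.domain, Tendsto (fun n => ‖(u n : H)‖) atTop (𝓝 0) →
    Tendsto (fun p : ℕ × ℕ => q.quad (u p.1 - u p.2)) atTop (𝓝 0) →
    Tendsto (fun n => q.quad (u n)) atTop (𝓝 0)

theorem ofReal_quad (q : NonnegForm H) (f : q.domain) : (q.quad f : ℂ) = q.form f f :=
  Complex.conj_eq_iff_re.1 (q.hermitian f f)

theorem quad_nonneg (q : NonnegForm H) (f : q.domain) : 0 ≤ q.quad f := q.nonneg f

theorem quad_smul (q : NonnegForm H) (c : ℂ) (f : q.domain) :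
    q.quad (c • f) = ‖c‖ ^ 2 * q.quad f := by
  apply Complex.ofReal_injective
  rw [Complex.ofReal_mul, ofReal_quad, ofReal_quad]
  simp only [map_smulₛₗ, LinearMap.smul_apply, smul_eq_mul, RingHom.id_apply]
  rw [← mul_assoc, mul_comm c, Complex.conj_mul']
  push_cast
  ring

theorem quad_add_add_quad_sub (q : NonnegForm H) (f g : q.domain) :
    q.quad (f + g) + q.quad (f - g) = 2 * q.quad f + 2 * q.quad g := by
  simp only [quad, map_add, map_sub, LinearMap.add_apply, LinearMap.sub_apply, Complex.add_re,
    Complex.sub_re]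
  ring

theorem quad_add_le (q : NonnegForm H) (f g : q.domain) :
    q.quad (f + g) ≤ 2 * q.quad f + 2 * q.quad g := by
  linarith [q.quad_add_add_quad_sub f g, q.quad_nonneg (f - g)]

theorem polarization (q : NonnegForm H) (f g : q.domain) :
    q.form f g = ((q.quad (f + g) : ℂ) - q.quad (f - g)
      - Complex.I * q.quad (f + Complex.I • g) + Complex.I * q.quad (f - Complex.I • g)) / 4 := by
  simp only [ofReal_quad, map_add, map_sub, LinearMap.add_apply, LinearMap.sub_apply, map_smulₛₗ,
    LinearMap.smul_apply, smul_eq_mul, RingHom.id_apply, Complex.conj_I]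
  linear_combination ((q.form f g - q.form g f) / 2) * Complex.I_sq

/-- The semi-inner product given by the form. -/
@[reducible] def core (q : NonnegForm H) : PreInnerProductSpace.Core ℂ q.domain where
  inner f g := q.form f g
  conj_inner_symm f g := q.hermitian g f
  re_inner_nonneg f := q.nonneg f
  add_left f g h := by simp
  smul_left f g c := by simp

theorem sqrt_quad_add_le (q : NonnegForm H) (f g : q.domain) :
    √(q.quad (f + g)) ≤ √(q.quad f) + √(q.quad g) := by
  let _ := q.core
  let _ := InnerProductSpace.Core.toSeminormedAddCommGroup (𝕜 := ℂ) (F := q.domain)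
  exact norm_add_le f g

theorem abs_sqrt_quad_sub_le (q : NonnegForm H) (f g : q.domain) :
    |√(q.quad f) - √(q.quad g)| ≤ √(q.quad (f - g)) := by
  have h1 := q.sqrt_quad_add_le (f - g) g
  have h2 := q.sqrt_quad_add_le (g - f) f
  have h3 : q.quad (g - f) = q.quad (f - g) := by
    have := q.quad_smul (-1) (f - g)
    simpa using this
  rw [sub_add_cancel] at h1 h2
  rw [h3] at h2
  rw [abs_le]
  constructor <;> linarith

theorem approx_const (q : NonnegForm H) (f : q.domain) : q.Approx (fun _ => f) (f : H) := by
  refine ⟨tendsto_const_nhds, ?_⟩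
  simp [quad]

theorem Approx.add {q : NonnegForm H} {u v : ℕ → q.domain} {f g : H} (hu : q.Approx u f)
    (hv : q.Approx v g) : q.Approx (fun n => u n + v n) (f + g) := by
  refine ⟨hu.1.add hv.1, ?_⟩
  have h := (hu.2.const_mul 2).add (hv.2.const_mul 2)
  simp only [mul_zero, add_zero] at h
  refine squeeze_zero (fun p => q.quad_nonneg _) (fun p => ?_) h
  rw [add_sub_add_comm]
  exact q.quad_add_le _ _

theorem Approx.smul {q : NonnegForm H} {u : ℕ → q.domain} {f : H} (c : ℂ) (hu : q.Approx u f) :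
    q.Approx (fun n => c • u n) (c • f) := by
  refine ⟨hu.1.const_smul c, ?_⟩
  have h := hu.2.const_mul (‖c‖ ^ 2)
  simp only [mul_zero] at h
  refine h.congr fun p => ?_
  rw [← smul_sub, quad_smul]

theorem Approx.sub {q : NonnegForm H} {u v : ℕ → q.domain} {f g : H} (hu : q.Approx u f)
    (hv : q.Approx v g) : q.Approx (fun n => u n - v n) (f - g) := by
  have h := hu.add (hv.smul (-1))
  simpa [sub_eq_add_neg] using h

/-- The domain of the closure of `q`. -/
def closureDomain (q : NonnegForm H) : Submodule ℂ H where
  carrier := {f | ∃ u : ℕ → q.domain, q.Approx u f}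
  zero_mem' := ⟨fun _ => 0, q.approx_const 0⟩
  add_mem' := fun ⟨_, hu⟩ ⟨_, hv⟩ => ⟨_, hu.add hv⟩
  smul_mem' := fun c _ ⟨_, hu⟩ => ⟨_, hu.smul c⟩

theorem Approx.exists_tendsto_quad {q : NonnegForm H} {u : ℕ → q.domain} {f : H}
    (hu : q.Approx u f) : ∃ a : ℝ, Tendsto (fun n => q.quad (u n)) atTop (𝓝 a) := by
  have hc : CauchySeq (fun n => √(q.quad (u n))) := by
    rw [cauchySeq_iff_tendsto_dist_atTop_0]
    have h := (Real.continuous_sqrt.tendsto 0).comp hu.2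
    rw [Real.sqrt_zero] at h
    exact squeeze_zero (fun _ => dist_nonneg) (fun p => q.abs_sqrt_quad_sub_le _ _) h
  obtain ⟨b, hb⟩ := cauchySeq_tendsto_of_complete hc
  refine ⟨b ^ 2, (hb.pow 2).congr fun n => ?_⟩
  exact Real.sq_sqrt (q.quad_nonneg _)

theorem Approx.tendsto_quad_of_tendsto {q : NonnegForm H} (hq : q.IsClosable)
    {u v : ℕ → q.domain} {f : H} (hu : q.Approx u f) (hv : q.Approx v f) {a : ℝ}
    (ha : Tendsto (fun n => q.quad (u n)) atTop (𝓝 a)) :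
    Tendsto (fun n => q.quad (v n)) atTop (𝓝 a) := by
  have hd : q.Approx (fun n => v n - u n) (f - f) := hv.sub hu
  rw [sub_self] at hd
  have h0 : Tendsto (fun n => q.quad (v n - u n)) atTop (𝓝 0) :=
    hq (fun n => v n - u n) (tendsto_zero_iff_norm_tendsto_zero.1 hd.1) hd.2
  have h1 : Tendsto (fun n => √(q.quad (v n - u n))) atTop (𝓝 0) := by
    simpa using h0.sqrt
  have h2 : Tendsto (fun n => √(q.quad (v n)) - √(q.quad (u n))) atTop (𝓝 0) :=
    squeeze_zero_norm (fun n => q.abs_sqrt_quad_sub_le (v n) (u n)) h1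
  have h3 : Tendsto (fun n => √(q.quad (v n))) atTop (𝓝 (√a)) := by
    simpa using h2.add ha.sqrt
  have ha0 : 0 ≤ a := ge_of_tendsto' ha fun n => q.quad_nonneg (u n)
  have h4 := h3.pow 2
  rw [Real.sq_sqrt ha0] at h4
  exact h4.congr fun n => Real.sq_sqrt (q.quad_nonneg (v n))

theorem Approx.exists_tendsto_form {q : NonnegForm H} (hq : q.IsClosable) {u v : ℕ → q.domain}
    {f g : H} (hu : q.Approx u f) (hv : q.Approx v g) :
    ∃ a : ℂ, ∀ u' v' : ℕ → q.domain, q.Approx u' f → q.Approx v' g →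
      Tendsto (fun n => q.form (u' n) (v' n)) atTop (𝓝 a) := by
  obtain ⟨a, ha⟩ := (hu.add hv).exists_tendsto_quad
  obtain ⟨b, hb⟩ := (hu.sub hv).exists_tendsto_quad
  obtain ⟨c, hc⟩ := (hu.add (hv.smul Complex.I)).exists_tendsto_quad
  obtain ⟨d, hd⟩ := (hu.sub (hv.smul Complex.I)).exists_tendsto_quad
  refine ⟨((a : ℂ) - b - Complex.I * c + Complex.I * d) / 4, fun u' v' hu' hv' => ?_⟩
  have ha' := (hu.add hv).tendsto_quad_of_tendsto hq (hu'.add hv') ha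
  have hb' := (hu.sub hv).tendsto_quad_of_tendsto hq (hu'.sub hv') hb
  have hc' := (hu.add (hv.smul Complex.I)).tendsto_quad_of_tendsto hq
    (hu'.add (hv'.smul Complex.I)) hc
  have hd' := (hu.sub (hv.smul Complex.I)).tendsto_quad_of_tendsto hq
    (hu'.sub (hv'.smul Complex.I)) hd
  have cast : ∀ {w : ℕ → ℝ} {x : ℝ}, Tendsto w atTop (𝓝 x) →
      Tendsto (fun n => (w n : ℂ)) atTop (𝓝 (x : ℂ)) :=
    fun h => (Complex.continuous_ofReal.tendsto _).comp h
  simp only [polarization]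
  exact ((((cast ha').sub (cast hb')).sub ((cast hc').const_mul _)).add
    ((cast hd').const_mul _)).div_const 4

/-- The value `q'(f, g) = lim q(u n, v n)`, for any `u n → f`, `v n → g` as in `Approx`. -/
def closureVal (q : NonnegForm H) (f g : q.closureDomain) : ℂ :=
  limUnder atTop fun n => q.form (f.2.choose n) (g.2.choose n)

theorem tendsto_closureVal (q : NonnegForm H) (hq : q.IsClosable) (f g : q.closureDomain)
    {u v : ℕ → q.domain} (hu : q.Approx u f) (hv : q.Approx v g) :
    Tendsto (fun n => q.form (u n) (v n)) atTop (𝓝 (q.closureVal f g)) := by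
  obtain ⟨a, ha⟩ := hu.exists_tendsto_form hq hv
  have h : q.closureVal f g = a := (ha _ _ f.2.choose_spec g.2.choose_spec).limUnder_eq
  rw [h]
  exact ha u v hu hv

/-- The closure `q'` of a closable form `q`. -/
def closure (q : NonnegForm H) (hq : q.IsClosable) : NonnegForm H where
  domain := q.closureDomain
  form := LinearMap.mk₂'ₛₗ (starRingEnd ℂ) (RingHom.id ℂ) q.closureVal
    (by
      intro f f' g
      obtain ⟨u, hu⟩ := f.2
      obtain ⟨u', hu'⟩ := f'.2
      obtain ⟨v, hv⟩ := g.2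
      refine tendsto_nhds_unique (q.tendsto_closureVal hq (f + f') g (hu.add hu') hv) ?_
      simpa using (q.tendsto_closureVal hq f g hu hv).add (q.tendsto_closureVal hq f' g hu' hv))
    (by
      intro c f g
      obtain ⟨u, hu⟩ := f.2
      obtain ⟨v, hv⟩ := g.2
      refine tendsto_nhds_unique (q.tendsto_closureVal hq (c • f) g (hu.smul c) hv) ?_
      simpa using (q.tendsto_closureVal hq f g hu hv).const_mul (conj c))
    (by
      intro f g g'
      obtain ⟨u, hu⟩ := f.2
      obtain ⟨v, hv⟩ := g.2
      obtain ⟨v', hv'⟩ := g'.2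
      refine tendsto_nhds_unique (q.tendsto_closureVal hq f (g + g') hu (hv.add hv')) ?_
      simpa using (q.tendsto_closureVal hq f g hu hv).add (q.tendsto_closureVal hq f g' hu hv'))
    (by
      intro c f g
      obtain ⟨u, hu⟩ := f.2
      obtain ⟨v, hv⟩ := g.2
      refine tendsto_nhds_unique (q.tendsto_closureVal hq f (c • g) hu (hv.smul c)) ?_
      simpa using (q.tendsto_closureVal hq f g hu hv).const_mul c)
  hermitian := by
    intro f g
    obtain ⟨u, hu⟩ := f.2
    obtain ⟨v, hv⟩ := g.2
    refine tendsto_nhds_unique ((Complex.continuous_conj.tendsto _).comp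
      (q.tendsto_closureVal hq f g hu hv)) ?_
    exact (q.tendsto_closureVal hq g f hv hu).congr fun n => (q.hermitian _ _).symm
  nonneg := by
    intro f
    obtain ⟨u, hu⟩ := f.2
    exact ge_of_tendsto' ((Complex.continuous_re.tendsto _).comp
      (q.tendsto_closureVal hq f f hu hu)) fun n => q.nonneg _

/-- The operator `T` associated with the form `q`: `f ∈ D(T)` and `T f = h` if and only if
`f ∈ D(q)` and `q(g, f) = ⟪g, h⟫` for all `g ∈ D(q)`. (For a closed, densely defined `q` this is
the non-negative selfadjoint operator of the representation theorem.) -/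
def toOperator (q : NonnegForm H) : H →ₗ.[ℂ] H :=
  Submodule.toLinearPMap
    { carrier := {p | ∃ hf : p.1 ∈ q.domain,
        ∀ g : q.domain, q.form g ⟨p.1, hf⟩ = inner ℂ (g : H) p.2}
      zero_mem' := ⟨q.domain.zero_mem, fun g => by
        rw [Prod.snd_zero, inner_zero_right]
        exact map_zero (q.form g)⟩
      add_mem' := fun {p r} ⟨hp, hp'⟩ ⟨hr, hr'⟩ => ⟨q.domain.add_mem hp hr, fun g => by
        have h := map_add (q.form g) ⟨p.1, hp⟩ ⟨r.1, hr⟩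
        rw [hp', hr'] at h
        simpa [inner_add_right] using h⟩
      smul_mem' := fun c p ⟨hp, hp'⟩ => ⟨q.domain.smul_mem c hp, fun g => by
        have h := map_smul (q.form g) c ⟨p.1, hp⟩
        rw [hp'] at h
        simpa [inner_smul_right] using h⟩ }

end NonnegForm

namespace LinearPMap

variable {H : Type*} [NormedAddCommGroup H] [InnerProductSpace ℂ H]

/-- Product of unbounded operators: `D(T R) = {x ∈ D(R) : R x ∈ D(T)}`, `x ↦ T (R x)`. -/
def mulOp (T R : H →ₗ.[ℂ] H) : H →ₗ.[ℂ] H :=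
  T.comp (R.domRestrict ((T.domain.comap R.toFun).map R.domain.subtype)) (by
    rintro ⟨x, ⟨y, hy, rfl⟩, hx⟩
    exact hy)

/-- The kernel of an unbounded operator, as a subspace of the whole space. -/
def kernel (T : H →ₗ.[ℂ] H) : Submodule ℂ H := (LinearMap.ker T.toFun).map T.domain.subtype

/-- The projection `u + n ↦ u` onto `U` along `N`, with domain `U + N`
(for subspaces with `U ∩ N = {0}`). -/
def projAlong (U N : Submodule ℂ H) : H →ₗ.[ℂ] H :=
  ((U.prod N).map ((LinearMap.fst ℂ H H + LinearMap.snd ℂ H H).prod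
    (LinearMap.fst ℂ H H))).toLinearPMap

/-- Dissipative operators. -/
def IsDissipative (A : H →ₗ.[ℂ] H) : Prop :=
  Dense (A.domain : Set H) ∧ ∀ f : A.domain, 0 ≤ (inner ℂ (f : H) (A f)).im

/-- Accretive operators. -/
def IsAccretive (A : H →ₗ.[ℂ] H) : Prop := (Complex.I • A).IsDissipative

/-- Strictly positive symmetric (in particular densely defined) operators. -/
def IsStrictlyPositiveSymmetric (S : H →ₗ.[ℂ] H) : Prop :=
  Dense (S.domain : Set H) ∧ S.IsFormalAdjoint S ∧
    ∃ ε : ℝ, 0 < ε ∧ ∀ f : S.domain, ε * ‖(f : H)‖ ^ 2 ≤ (inner ℂ (f : H) (S f)).re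

/-- The form `q_A(f) = Im ⟪f, A f⟫` on `D(A)` of a dissipative operator `A`; its sesquilinear
version is `(⟪f, A g⟫ - ⟪A f, g⟫) / (2 i)`. -/
def imForm (A : H →ₗ.[ℂ] H) (hA : A.IsDissipative) : NonnegForm H where
  domain := A.domain
  form := LinearMap.mk₂'ₛₗ (starRingEnd ℂ) (RingHom.id ℂ)
    (fun f g => (inner ℂ (f : H) (A g) - inner ℂ (A f) (g : H)) / (2 * Complex.I))
    (by intro f f' g; simp only [map_add, Submodule.coe_add, inner_add_left]; ring)
    (by intro c f g; simp only [map_smul, Submodule.coe_smul, inner_smul_left, smul_eq_mul]; ring)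
    (by intro f g g'; simp only [map_add, Submodule.coe_add, inner_add_right]; ring)
    (by intro c f g; simp only [map_smul, Submodule.coe_smul, inner_smul_right, smul_eq_mul,
          RingHom.id_apply]; ring)
  hermitian := by
    intro f g
    simp only [LinearMap.mk₂'ₛₗ_apply, map_div₀, map_mul, Complex.conj_I, Complex.conj_ofNat]
    rw [RingHom.map_sub, inner_conj_symm, inner_conj_symm, mul_neg, div_neg, ← neg_div, neg_sub]
  nonneg := by
    intro f
    have h : (inner ℂ (f : H) (A f) - inner ℂ (A f) (f : H)) / (2 * Complex.I)
        = ((inner ℂ (f : H) (A f)).im : ℂ) := by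
      rw [← inner_conj_symm (A f) (f : H), Complex.sub_conj]
      field_simp
      push_cast
      ring
    simp only [LinearMap.mk₂'ₛₗ_apply, h, Complex.ofReal_re]
    exact hA.2 f

/-- The imaginary part `V_A` of a dissipative operator `A` for which `q_A` is closable: the operator
associated with the closure of `q_A`. -/
def imPart (A : H →ₗ.[ℂ] H) (hA : A.IsDissipative) (hq : (A.imForm hA).IsClosable) : H →ₗ.[ℂ] H :=
  ((A.imForm hA).closure hq).toOperator

/-- The form `(f, g) ↦ ⟪f, S g⟫` on `D(S)` of a strictly positive symmetric operator `S`. -/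
def symmForm (S : H →ₗ.[ℂ] H) (hS : S.IsStrictlyPositiveSymmetric) : NonnegForm H where
  domain := S.domain
  form := LinearMap.mk₂'ₛₗ (starRingEnd ℂ) (RingHom.id ℂ)
    (fun f g => inner ℂ (f : H) (S g))
    (by intro f f' g; simp only [Submodule.coe_add, inner_add_left])
    (by intro c f g; simp only [Submodule.coe_smul, inner_smul_left, smul_eq_mul])
    (by intro f g g'; simp only [map_add, inner_add_right])
    (by intro c f g; simp only [map_smul, inner_smul_right, smul_eq_mul, RingHom.id_apply])
  hermitian := by
    intro f g
    simp only [LinearMap.mk₂'ₛₗ_apply, inner_conj_symm]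
    exact hS.2.1 g f
  nonneg := by
    intro f
    obtain ⟨ε, hε, h⟩ := hS.2.2
    simp only [LinearMap.mk₂'ₛₗ_apply]
    exact le_trans (by positivity) (h f)

variable [CompleteSpace H]

/-- `R` is a non-negative selfadjoint square root of `T`. -/
def IsNonnegSqrt (T R : H →ₗ.[ℂ] H) : Prop :=
  IsSelfAdjoint R ∧ (∀ f : R.domain, 0 ≤ (inner ℂ (f : H) (R f)).re) ∧ R.mulOp R = T

open Classical in
/-- The square root `T^{1/2}` of a non-negative selfadjoint operator `T`: its (unique) non-negative
selfadjoint square root. -/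
def sqrtOp (T : H →ₗ.[ℂ] H) : H →ₗ.[ℂ] H :=
  if h : ∃ R, IsNonnegSqrt T R then h.choose else 0

/-- The operator `W_A : ran(V_A^{1/2} restricted to D(A)) → H`, `g ↦ A V_A^{-1/2} g`. -/
def wOp (A : H →ₗ.[ℂ] H) (hA : A.IsDissipative) (hq : (A.imForm hA).IsClosable) : H →ₗ.[ℂ] H :=
  A.mulOp ((A.imPart hA hq).sqrtOp.domRestrict A.domain).inverse

/-- The Friedrichs extension `S_F`: the restriction of `S*` to `D(S*) ∩ H_S`, where `H_S` is the
completion (inside `H`) of `D(S)` in the norm given by `⟪f, S f⟫`. -/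
def friedrichs (S : H →ₗ.[ℂ] H) (hS : S.IsStrictlyPositiveSymmetric) : H →ₗ.[ℂ] H :=
  S.adjoint.domRestrict (S.symmForm hS).closureDomain

/-- The Kreĭn–von Neumann extension `S_K`: the restriction of `S*` to `D(closure of S) + ker S*`. -/
def krein (S : H →ₗ.[ℂ] H) : H →ₗ.[ℂ] H :=
  S.adjoint.domRestrict (S.closure.domain ⊔ S.adjoint.kernel)

end LinearPMap

end

set_option linter.unusedSectionVars false

/-! Everything is expressed through one bounded operator. Let `K` be the completion of `D(S)` in the
energy norm `⟪f, S f⟫` and `j : K → H` the extension of the inclusion, bounded because `S ≥ ε`.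
Since `j* S f` is the copy of `f` in `K`, a vector `k` with `j k ⊥ ran S` is orthogonal to a dense
set, so `k = 0`. In particular `j` is injective, which is closability of the form, and `G = j j*` is
positive, injective and satisfies `G S f = f`. Both the Friedrichs extension and the operator of the
closed form of `i S` are `G⁻¹`, and `S_F^{1/2}` is the inverse of `√G`.

Let `P` project onto the closure `R` of `ran S`, so that `ker S* = Rᗮ`. The closure of `S` is the
part of `G⁻¹` with values in `R`, hence `S_K` is the inverse of the compression `P G P`, extended by
zero on `Rᗮ` (`krein_eq_pinv`). Because `‖√(P G P) y‖ = ‖√G P y‖`, Douglas' range lemma identifies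
`ran √(P G P)` with `ran (P √G)`, which gives `D(S_K^{1/2}) = ran √G + Rᗮ`.

The operator `W_A` sends `√G S f` to `i S f`, so `(x, y)` is in the graph of `W_A*` exactly when `x
- √G (i y) ⊥ ran S`; the domain and the formula can be read off. For an accretive extension `B`,
Cauchy–Schwarz for the real part of `⟪f, B f⟫` bounds `⟪f, S g⟫` by a multiple of `‖√G S g‖`, and
the range lemma again puts `f` in `ran √G + Rᗮ`. -/

noncomputable section

/-! ### Ranges of bounded operators (Douglas' lemma). -/

section Range

variable {E F : Type*} [NormedAddCommGroup E] [InnerProductSpace ℂ E] [CompleteSpace E]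
  [NormedAddCommGroup F] [InnerProductSpace ℂ F] [CompleteSpace F]

/-- A vector lies in the range of a bounded operator `A` as soon as it induces a functional that is
bounded with respect to `y ↦ ‖A† y‖`. -/
theorem ContinuousLinearMap.mem_range_of_norm_inner_le (A : E →L[ℂ] F) (x : F) (c : ℝ)
    (h : ∀ y, ‖inner ℂ x y‖ ≤ c * ‖A.adjoint y‖) : ∃ w, A w = x := by
  obtain ⟨s, hs⟩ := (A.adjoint : F →ₗ[ℂ] E).rangeRestrict.exists_rightInverse_of_surjective
    (LinearMap.range_rangeRestrict _)
  have hs' : ∀ z, A.adjoint (s z) = z := fun z => congrArg Subtype.val (LinearMap.congr_fun hs z)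
  -- This is `A† y ↦ ⟪x, y⟫` on `ran A†`, bounded by hypothesis. The preimage `w` of `x` represents
  -- a Hahn–Banach extension. The choice of section `s` is harmless: `y` and `s (A† y)` have the
  -- same image, so the bound makes their pairings with `x` agree.
  let φ : StrongDual ℂ (LinearMap.range (A.adjoint : F →ₗ[ℂ] E)) :=
    ((innerₛₗ ℂ x).comp s).mkContinuous c fun z => by
      have := h (s z)
      rwa [hs' z] at this
  obtain ⟨ψ, hψ, -⟩ := exists_extension_norm_eq _ φ
  refine ⟨(InnerProductSpace.toDual ℂ E).symm ψ, ext_inner_right ℂ fun y => ?_⟩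
  rw [← ContinuousLinearMap.adjoint_inner_right, InnerProductSpace.toDual_symm_apply]
  have h1 := hψ ⟨A.adjoint y, y, rfl⟩
  have h2 : φ ⟨A.adjoint y, y, rfl⟩ = inner ℂ x (s ⟨A.adjoint y, y, rfl⟩) := rfl
  rw [h1, h2, ← sub_eq_zero, ← inner_sub_right, ← norm_le_zero_iff]
  refine (h _).trans ?_
  rw [map_sub, hs']
  simp

/-- If `‖A† y‖ ≤ ‖B† y‖` for all `y`, then the range of `A` is contained in that of `B`. -/
theorem ContinuousLinearMap.exists_apply_eq_of_norm_adjoint_le {E' : Type*}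
    [NormedAddCommGroup E'] [InnerProductSpace ℂ E'] [CompleteSpace E'] (A : E →L[ℂ] F)
    (B : E' →L[ℂ] F) (h : ∀ y, ‖A.adjoint y‖ ≤ ‖B.adjoint y‖) (x : E) : ∃ w, B w = A x := by
  refine B.mem_range_of_norm_inner_le (A x) ‖x‖ fun y => ?_
  rw [← ContinuousLinearMap.adjoint_inner_right]
  exact (norm_inner_le_norm _ _).trans (mul_le_mul_of_nonneg_left (h y) (norm_nonneg _))

end Range

/-! ### Graph calculus for unbounded operators. -/

namespace LinearPMap

variable {H : Type*} [NormedAddCommGroup H] [InnerProductSpace ℂ H]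

theorem mem_graph_mulOp (T R : H →ₗ.[ℂ] H) (x z : H) :
    (x, z) ∈ (T.mulOp R).graph ↔ ∃ y, (x, y) ∈ R.graph ∧ (y, z) ∈ T.graph := by
  constructor
  · intro h
    obtain ⟨⟨a, ⟨⟨b, hb, rfl⟩, hb'⟩⟩, rfl, rfl⟩ := (mem_graph_iff _).1 h
    exact ⟨R b, R.mem_graph b, T.mem_graph ⟨R b, hb⟩⟩
  · rintro ⟨y, h1, h2⟩
    obtain ⟨a, rfl, rfl⟩ := (mem_graph_iff _).1 h1
    obtain ⟨b, hb, rfl⟩ := (mem_graph_iff _).1 h2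
    replace hb : (b : H) = R a := hb
    refine (mem_graph_iff _).2 ⟨⟨a, ⟨a, ?_, rfl⟩, a.2⟩, rfl, ?_⟩
    · change R a ∈ T.domain
      rw [← hb]
      exact b.2
    · change T _ = T _
      congr 1
      exact Subtype.ext hb.symm

theorem mem_graph_domRestrict (T : H →ₗ.[ℂ] H) (U : Submodule ℂ H) (x y : H) :
    (x, y) ∈ (T.domRestrict U).graph ↔ x ∈ U ∧ (x, y) ∈ T.graph := by
  constructor
  · intro h
    exact ⟨(mem_domain_of_mem_graph h).1, le_graph_of_le domRestrict_le h⟩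
  · rintro ⟨hx, h⟩
    obtain ⟨a, rfl, rfl⟩ := (mem_graph_iff _).1 h
    exact (mem_graph_iff _).2 ⟨⟨a, hx, a.2⟩, rfl, rfl⟩

theorem mem_graph_smul (c : ℂ) (T : H →ₗ.[ℂ] H) (x z : H) :
    (x, z) ∈ (c • T).graph ↔ ∃ y, (x, y) ∈ T.graph ∧ c • y = z := by
  constructor
  · intro h
    obtain ⟨a, rfl, rfl⟩ := (mem_graph_iff _).1 h
    exact ⟨T a, T.mem_graph a, rfl⟩
  · rintro ⟨y, h, rfl⟩
    obtain ⟨a, rfl, rfl⟩ := (mem_graph_iff _).1 h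
    exact (mem_graph_iff _).2 ⟨a, rfl, rfl⟩

theorem mem_kernel (T : H →ₗ.[ℂ] H) (x : H) : x ∈ T.kernel ↔ (x, 0) ∈ T.graph := by
  rw [mem_graph_iff]
  constructor
  · rintro ⟨a, ha, rfl⟩
    exact ⟨a, rfl, ha⟩
  · rintro ⟨a, rfl, ha⟩
    exact ⟨a, ha, rfl⟩

theorem mem_graph_projAlong {U N : Submodule ℂ H} (h : Disjoint U N) (x y : H) :
    (x, y) ∈ (projAlong U N).graph ↔ y ∈ U ∧ x - y ∈ N := by
  rw [projAlong, Submodule.toLinearPMap_graph_eq]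
  · constructor
    · rintro ⟨⟨a, b⟩, ⟨ha, hb⟩, hab⟩
      obtain ⟨rfl, rfl⟩ := Prod.mk.inj hab
      exact ⟨ha, by simpa using hb⟩
    · rintro ⟨hy, hxy⟩
      exact ⟨(y, x - y), ⟨hy, hxy⟩, by simp⟩
  · rintro ⟨x, y⟩ ⟨⟨a, b⟩, ⟨ha, hb⟩, hab⟩ hx
    obtain ⟨rfl, rfl⟩ := Prod.mk.inj hab
    have hx' : a + b = 0 := hx
    refine Submodule.disjoint_def.1 h _ ha ?_
    change a ∈ N
    rw [eq_neg_of_add_eq_zero_left hx']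
    exact N.neg_mem hb

theorem mem_graph_inverse {T : H →ₗ.[ℂ] H} (h : ∀ x, (x, 0) ∈ T.graph → x = 0) (x y : H) :
    (x, y) ∈ T.inverse.graph ↔ (y, x) ∈ T.graph := by
  rw [inverse_graph]
  · simp
  · refine LinearMap.ker_eq_bot'.2 fun a ha => Subtype.ext (h a ?_)
    exact (mem_graph_iff _).2 ⟨a, rfl, ha⟩

theorem _root_.ContinuousLinearMap.IsPositive.apply_mem_orthogonal_ker {G : H →L[ℂ] H}
    (hG : G.IsPositive) (y : H) : G y ∈ G.kerᗮ := by
  intro n hn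
  rw [← hG.inner_left_eq_inner_right, show G n = 0 from hn, inner_zero_left]

theorem _root_.Submodule.eq_zero_of_mem_of_mem_orthogonal {N : Submodule ℂ H} {x : H}
    (h : x ∈ N) (h' : x ∈ Nᗮ) : x = 0 :=
  Submodule.disjoint_def.1 N.orthogonal_disjoint x h h'

variable [CompleteSpace H]

theorem mem_graph_adjoint {T : H →ₗ.[ℂ] H} (hT : Dense (T.domain : Set H)) (x y : H) :
    (x, y) ∈ T.adjoint.graph ↔ ∀ a b, (a, b) ∈ T.graph → inner ℂ b x = inner ℂ a y := by
  simp only [adjoint_graph_eq_graph_adjoint hT, Submodule.mem_adjoint_iff, sub_eq_zero]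

theorem _root_.IsSelfAdjoint.mem_graph_iff {T : H →ₗ.[ℂ] H} (hT : IsSelfAdjoint T) (x y : H) :
    (x, y) ∈ T.graph ↔ ∀ a b, (a, b) ∈ T.graph → inner ℂ b x = inner ℂ a y := by
  rw [← mem_graph_adjoint hT.dense_domain, isSelfAdjoint_def.1 hT]

/-! ### Inverses of bounded positive operators, and their square roots. -/

/-- The inverse of a bounded operator `G` on the orthogonal complement of `ker G`, extended
by zero to `ker G`. -/
def pinv (G : H →L[ℂ] H) : H →ₗ.[ℂ] H :=
  Submodule.toLinearPMap
    { carrier := {p | p.2 ∈ G.kerᗮ ∧ p.1 - G p.2 ∈ G.ker}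
      zero_mem' := by simp
      add_mem' := fun {p r} hp hr => ⟨add_mem hp.1 hr.1, by
        have := add_mem hp.2 hr.2
        rwa [← add_sub_add_comm, ← _root_.map_add] at this⟩
      smul_mem' := fun c p hp => ⟨Submodule.smul_mem _ c hp.1, by
        have := Submodule.smul_mem _ c hp.2
        rwa [smul_sub, ← _root_.map_smul] at this⟩ }

variable {G : H →L[ℂ] H}

theorem mem_graph_pinv (hG : G.IsPositive) (x y : H) :
    (x, y) ∈ (pinv G).graph ↔ y ∈ G.kerᗮ ∧ x - G y ∈ G.ker := by
  rw [pinv, Submodule.toLinearPMap_graph_eq]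
  · rfl
  · rintro ⟨x, y⟩ ⟨hy, hxy⟩ (rfl : x = 0)
    have h1 : G y ∈ G.ker := by simpa using G.ker.neg_mem hxy
    have h2 : G y = 0 :=
      Submodule.eq_zero_of_mem_of_mem_orthogonal h1 (hG.apply_mem_orthogonal_ker y)
    exact Submodule.eq_zero_of_mem_of_mem_orthogonal (N := G.ker) h2 hy

theorem exists_mem_orthogonal_ker_apply_eq (G : H →L[ℂ] H) (y : H) : ∃ z ∈ G.kerᗮ, G z = G y := by
  have : CompleteSpace G.ker := G.isClosed_ker.completeSpace_coe
  obtain ⟨n, hn, z, hz, h⟩ := G.ker.exists_add_mem_mem_orthogonal y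
  refine ⟨z, hz, ?_⟩
  rw [h, _root_.map_add, show G n = 0 from hn, zero_add]

theorem mem_domain_pinv (hG : G.IsPositive) (x : H) :
    x ∈ (pinv G).domain ↔ ∃ y, x - G y ∈ G.ker := by
  rw [mem_domain_iff]
  simp only [mem_graph_pinv hG]
  constructor
  · rintro ⟨y, -, h⟩
    exact ⟨y, h⟩
  · rintro ⟨y, h⟩
    obtain ⟨z, hz, hzy⟩ := exists_mem_orthogonal_ker_apply_eq G y
    exact ⟨z, hz, by rwa [hzy]⟩

/-- The domain contains `ker G` and `ran G`: a vector `b` orthogonal to it lies in `(ker G)ᗮ`, and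
pairing with `G (G b)` gives `G b = 0`. -/
theorem dense_domain_pinv (hG : G.IsPositive) : Dense ((pinv G).domain : Set H) := by
  rw [Submodule.dense_iff_topologicalClosure_eq_top, Submodule.topologicalClosure_eq_top_iff,
    Submodule.eq_bot_iff]
  intro b hb
  have hN : b ∈ G.kerᗮ := fun n hn => hb n ((mem_domain_pinv hG n).2 ⟨0, by simpa using hn⟩)
  refine Submodule.eq_zero_of_mem_of_mem_orthogonal (N := G.ker) ?_ hN
  change G b = 0
  rw [← inner_self_eq_zero (𝕜 := ℂ), ← hG.inner_left_eq_inner_right]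
  exact hb _ ((mem_domain_pinv hG _).2 ⟨G b, by simp⟩)

theorem isSelfAdjoint_pinv (hG : G.IsPositive) : IsSelfAdjoint (pinv G) := by
  have : CompleteSpace G.ker := G.isClosed_ker.completeSpace_coe
  rw [isSelfAdjoint_def]
  refine eq_of_eq_graph (Submodule.ext fun ⟨x, y⟩ => ?_)
  rw [mem_graph_adjoint (dense_domain_pinv hG), mem_graph_pinv hG]
  simp only [mem_graph_pinv hG]
  constructor
  · intro h
    -- Testing against the pairs `(n, 0)` with `n ∈ ker G` gives this; the pairs `(G z, z)` with `z
    -- ⊥ ker G` then give `x - G y ∈ ker G`.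
    have hy : y ∈ G.kerᗮ := fun n hn => by
      have := h n 0 ⟨zero_mem _, by simpa using hn⟩
      rw [← this, inner_zero_left]
    refine ⟨hy, ?_⟩
    rw [← G.ker.orthogonal_orthogonal]
    intro z hz
    have := h (G z) z ⟨hz, by simp⟩
    rw [inner_sub_right, this, hG.inner_left_eq_inner_right, sub_self]
  · rintro ⟨hy, hxy⟩ a b ⟨hb, hab⟩
    have h1 := hy _ hab
    have h2 := Submodule.inner_left_of_mem_orthogonal hxy hb
    rw [inner_sub_left, sub_eq_zero] at h1
    rw [inner_sub_right, sub_eq_zero] at h2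
    rw [h1, h2, hG.inner_left_eq_inner_right]

theorem pinv_nonneg (hG : G.IsPositive) (f : (pinv G).domain) :
    0 ≤ (inner ℂ (f : H) (pinv G f)).re := by
  obtain ⟨h1, h2⟩ := (mem_graph_pinv hG _ _).1 ((pinv G).mem_graph f)
  have h3 := h1 _ h2
  rw [inner_sub_left, sub_eq_zero] at h3
  rw [h3]
  exact hG.re_inner_nonneg_left _

theorem _root_.ContinuousLinearMap.IsPositive.isPositive_sqrt (G : H →L[ℂ] H) :
    (CFC.sqrt G).IsPositive :=
  (ContinuousLinearMap.nonneg_iff_isPositive _).1 (CFC.sqrt_nonneg G)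

theorem _root_.ContinuousLinearMap.IsPositive.sqrt_apply_sqrt_apply (hG : G.IsPositive) (x : H) :
    CFC.sqrt G (CFC.sqrt G x) = G x :=
  congrArg (fun T : H →L[ℂ] H => T x)
    (CFC.sqrt_mul_sqrt_self G ((ContinuousLinearMap.nonneg_iff_isPositive _).2 hG))

theorem _root_.ContinuousLinearMap.IsPositive.ker_sqrt (hG : G.IsPositive) :
    (CFC.sqrt G).ker = G.ker := by
  ext x
  change CFC.sqrt G x = 0 ↔ G x = 0
  rw [← hG.sqrt_apply_sqrt_apply]
  refine ⟨fun h => by rw [h, _root_.map_zero], fun h => ?_⟩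
  rw [← inner_self_eq_zero (𝕜 := ℂ),
    (ContinuousLinearMap.IsPositive.isPositive_sqrt G).inner_left_eq_inner_right, h,
    inner_zero_right]

theorem isNonnegSqrt_pinv_sqrt (hG : G.IsPositive) :
    (pinv G).IsNonnegSqrt (pinv (CFC.sqrt G)) := by
  have hM := ContinuousLinearMap.IsPositive.isPositive_sqrt G
  refine ⟨isSelfAdjoint_pinv hM, pinv_nonneg hM, ?_⟩
  refine eq_of_eq_graph (Submodule.ext fun ⟨x, z⟩ => ?_)
  simp only [mem_graph_mulOp, mem_graph_pinv hG, mem_graph_pinv hM, hG.ker_sqrt]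
  constructor
  · rintro ⟨y, ⟨hy, hxy⟩, hz, hyz⟩
    refine ⟨hz, ?_⟩
    have h : y - CFC.sqrt G z = 0 := Submodule.eq_zero_of_mem_of_mem_orthogonal hyz
      (sub_mem hy (hG.ker_sqrt ▸ hM.apply_mem_orthogonal_ker z))
    rwa [sub_eq_zero.1 h, hG.sqrt_apply_sqrt_apply] at hxy
  · rintro ⟨hz, hxz⟩
    refine ⟨CFC.sqrt G z, ⟨hG.ker_sqrt ▸ hM.apply_mem_orthogonal_ker z, ?_⟩, hz, by simp⟩
    rwa [hG.sqrt_apply_sqrt_apply]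

/-- Uniqueness of the square root is reduced to the bounded case. The inverse `M` of `R` on `(ker
G)ᗮ`, extended by zero, is everywhere defined and symmetric, hence bounded by Hellinger–Toeplitz; it
is positive with `M² = G`, so it is `CFC.sqrt G`. -/
theorem IsNonnegSqrt.eq_pinv_sqrt (hG : G.IsPositive) {R : H →ₗ.[ℂ] H}
    (hR : (pinv G).IsNonnegSqrt R) : R = pinv (CFC.sqrt G) := by
  have : CompleteSpace G.ker := G.isClosed_ker.completeSpace_coe
  have hsymm {a b x y : H} (hab : (a, b) ∈ R.graph) (hxy : (x, y) ∈ R.graph) :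
      inner ℂ b x = inner ℂ a y := (hR.1.mem_graph_iff x y).1 hxy a b hab
  have hsq (x z : H) : (∃ y, (x, y) ∈ R.graph ∧ (y, z) ∈ R.graph) ↔
      z ∈ G.kerᗮ ∧ x - G z ∈ G.ker := by
    rw [← mem_graph_mulOp, hR.2.2, mem_graph_pinv hG]
  have hker {n : H} : (n, 0) ∈ R.graph ↔ n ∈ G.ker := by
    constructor
    · intro h
      simpa using ((hsq n 0).1 ⟨0, h, R.graph.zero_mem⟩).2
    · intro hn
      -- With `R n = y` and `R y = 0`, symmetry gives `⟪y, y⟫ = ⟪n, 0⟫ = 0`.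
      obtain ⟨y, h1, h2⟩ := (hsq n 0).2 ⟨zero_mem _, by simpa using hn⟩
      have h3 := hsymm h1 h2
      rw [inner_zero_right, inner_self_eq_zero] at h3
      rwa [h3] at h1
  have hran {x y : H} (h : (x, y) ∈ R.graph) : y ∈ G.kerᗮ := fun n hn => by
    rw [← hsymm (hker.2 hn) h, inner_zero_left]
  -- Here `z` is the projection of `y` to `(ker G)ᗮ` and `x = M y` its preimage under `R`, made
  -- unique by discarding its component in `ker G = ker R`.
  have hex (y : H) : ∃ x z, x ∈ G.kerᗮ ∧ z ∈ G.kerᗮ ∧ y - z ∈ G.ker ∧ (x, z) ∈ R.graph := by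
    obtain ⟨n, hn, z, hz, rfl⟩ := G.ker.exists_add_mem_mem_orthogonal y
    obtain ⟨x, -, hx⟩ := (hsq (G z) z).2 ⟨hz, by simp⟩
    obtain ⟨m, hm, w, hw, rfl⟩ := G.ker.exists_add_mem_mem_orthogonal x
    refine ⟨w, z, hw, hz, by simpa using hn, ?_⟩
    simpa using sub_mem hx (hker.2 hm)
  choose M z hM hz hyz hMz using hex
  have hM_unique {x y w : H} (hx : x ∈ G.kerᗮ) (hyw : y - w ∈ G.ker) (h : (x, w) ∈ R.graph) :
      x = M y := by
    have hw : w - z y = 0 := by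
      refine Submodule.eq_zero_of_mem_of_mem_orthogonal ?_ (sub_mem (hran h) (hz y))
      simpa using sub_mem (hyz y) hyw
    have h1 := sub_mem h (hMz y)
    rw [Prod.mk_sub_mk, hw] at h1
    exact sub_eq_zero.1 (Submodule.eq_zero_of_mem_of_mem_orthogonal (hker.1 h1)
      (sub_mem hx (hM y)))
  let L : H →ₗ[ℂ] H :=
    { toFun := M
      map_add' := fun x y => (hM_unique (add_mem (hM x) (hM y))
        (by simpa only [add_sub_add_comm] using add_mem (hyz x) (hyz y))
        (add_mem (hMz x) (hMz y))).symm
      map_smul' := fun c x => (hM_unique (Submodule.smul_mem _ c (hM x))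
        (by simpa only [smul_sub] using Submodule.smul_mem _ c (hyz x))
        (Submodule.smul_mem _ c (hMz x))).symm }
  have hinner (x y : H) : inner ℂ (M x) y = inner ℂ (M x) (z y) := by
    rw [← sub_eq_zero, ← inner_sub_right]
    exact Submodule.inner_left_of_mem_orthogonal (hyz y) (hM x)
  have hL : L.IsSymmetric := fun x y => by
    change inner ℂ (M x) y = inner ℂ x (M y)
    rw [hinner, ← hsymm (hMz x) (hMz y), ← inner_conj_symm x, hinner, inner_conj_symm]
  let B : H →L[ℂ] H := ⟨L, hL.continuous⟩
  have hB : B.IsPositive := by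
    refine ContinuousLinearMap.isPositive_def.2 ⟨hL, fun x => ?_⟩
    change 0 ≤ (inner ℂ (M x) x).re
    rw [hinner]
    obtain ⟨f, hf, hf'⟩ := (mem_graph_iff _).1 (hMz x)
    rw [← show (f : H) = M x from hf, ← show R f = z x from hf']
    exact hR.2.1 f
  have hBB : B * B = G := by
    ext y
    change M (M y) = G y
    have h1 := hMz (M y)
    have h2 : z (M y) = M y := (sub_eq_zero.1 (Submodule.eq_zero_of_mem_of_mem_orthogonal
      (hyz (M y)) (sub_mem (hM y) (hz _)))).symm
    rw [h2] at h1
    have h3 := ((hsq _ _).1 ⟨_, h1, hMz y⟩).2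
    have h4 : G (z y) = G y := by
      have : G (y - z y) = 0 := hyz y
      rw [_root_.map_sub, sub_eq_zero] at this
      exact this.symm
    rw [← h4]
    exact sub_eq_zero.1 (Submodule.eq_zero_of_mem_of_mem_orthogonal h3
      (sub_mem (hM _) (hG.apply_mem_orthogonal_ker _)))
  have hBG : CFC.sqrt G = B :=
    CFC.sqrt_unique hBB ((ContinuousLinearMap.nonneg_iff_isPositive _).2 hB)
  have hMy {y : H} (hy : y ∈ G.kerᗮ) : (M y, y) ∈ R.graph := by
    have h : z y = y := (sub_eq_zero.1 (Submodule.eq_zero_of_mem_of_mem_orthogonal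
      (hyz y) (sub_mem hy (hz _)))).symm
    simpa only [h] using hMz y
  refine eq_of_eq_graph (Submodule.ext fun ⟨x, y⟩ => ?_)
  rw [mem_graph_pinv (ContinuousLinearMap.IsPositive.isPositive_sqrt G), hG.ker_sqrt, hBG]
  change _ ↔ y ∈ G.kerᗮ ∧ x - M y ∈ G.ker
  constructor
  · intro h
    refine ⟨hran h, hker.1 ?_⟩
    simpa using sub_mem h (hMy (hran h))
  · rintro ⟨hy, hxy⟩
    simpa using add_mem (hker.2 hxy) (hMy hy)

theorem sqrtOp_pinv (hG : G.IsPositive) : (pinv G).sqrtOp = pinv (CFC.sqrt G) := by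
  have h : ∃ R, IsNonnegSqrt (pinv G) R := ⟨_, isNonnegSqrt_pinv_sqrt hG⟩
  rw [sqrtOp, dif_pos h]
  exact h.choose_spec.eq_pinv_sqrt hG

end LinearPMap

/-! ### Hilbert space models of a form and of its closure. -/

namespace NonnegForm

variable {H : Type*} [NormedAddCommGroup H] [InnerProductSpace ℂ H]

/-- The domain of a non-negative form, as a space with the semi-norm given by the form. -/
def EnergyDomain (q : NonnegForm H) : Type _ := q.domain

namespace EnergyDomain

variable (q : NonnegForm H)

instance : AddCommGroup q.EnergyDomain := inferInstanceAs (AddCommGroup q.domain)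

instance : Module ℂ q.EnergyDomain := inferInstanceAs (Module ℂ q.domain)

/-- The semi-inner product given by the form. -/
@[reducible] def innerCore : PreInnerProductSpace.Core ℂ q.EnergyDomain := q.core

instance : SeminormedAddCommGroup q.EnergyDomain :=
  @InnerProductSpace.Core.toSeminormedAddCommGroup ℂ q.EnergyDomain _ _ _ (innerCore q)

instance : InnerProductSpace ℂ q.EnergyDomain := InnerProductSpace.ofCore (innerCore q)

/-- The identity map, to the domain with its original norm. -/
def toDomain : q.EnergyDomain →ₗ[ℂ] q.domain where
  toFun f := f
  map_add' _ _ := rfl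
  map_smul' _ _ := rfl

/-- The identity map, from the domain with its original norm. -/
def ofDomain : q.domain →ₗ[ℂ] q.EnergyDomain where
  toFun f := f
  map_add' _ _ := rfl
  map_smul' _ _ := rfl

end EnergyDomain

/-- A Hilbert space realization of a non-negative form `q`: the domain of `q` embeds densely and
isometrically (for the energy semi-norm), and the inclusion of the domain in `H` extends
continuously. -/
structure Model (q : NonnegForm H) (K : Type*) [NormedAddCommGroup K] [InnerProductSpace ℂ K] where
  /-- the embedding of the domain of the form -/
  emb : q.domain →ₗ[ℂ] K
  /-- the extension of the inclusion `q.domain → H` -/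
  incl : K →L[ℂ] H
  denseRange_emb : DenseRange emb
  inner_emb : ∀ f g, inner ℂ (emb f) (emb g) = q.form f g
  incl_emb : ∀ f, incl (emb f) = f

/-- The completion of the domain of a form that is bounded below by a positive constant. -/
def completionModel [CompleteSpace H] (q : NonnegForm H) {ε : ℝ} (hε : 0 < ε)
    (h : ∀ f : q.domain, ε * ‖(f : H)‖ ^ 2 ≤ q.quad f) :
    q.Model (UniformSpace.Completion q.EnergyDomain) :=
  -- The lower bound `ε` makes the inclusion continuous for the energy norm, with constant `1 / √ε`.
  let j : q.EnergyDomain →L[ℂ] H := LinearMap.mkContinuous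
      (q.domain.subtype ∘ₗ EnergyDomain.toDomain q) (√ε)⁻¹ fun f => by
    have h1 : ‖f‖ = √(q.quad (EnergyDomain.toDomain q f)) := rfl
    rw [h1, ← Real.sqrt_inv, ← Real.sqrt_mul (inv_nonneg.2 hε.le)]
    refine Real.le_sqrt_of_sq_le ?_
    rw [← div_eq_inv_mul, le_div_iff₀ hε, mul_comm]
    exact h f
  { emb := (UniformSpace.Completion.toComplₗᵢ (𝕜 := ℂ) (E := q.EnergyDomain)).toLinearMap ∘ₗ
      EnergyDomain.ofDomain q
    incl := j.extend (UniformSpace.Completion.toComplL (𝕜 := ℂ) (E := q.EnergyDomain))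
    denseRange_emb := UniformSpace.Completion.denseRange_coe (α := q.EnergyDomain)
    inner_emb := fun f g => UniformSpace.Completion.inner_coe (𝕜 := ℂ) (E := q.EnergyDomain)
      (EnergyDomain.ofDomain q f) (EnergyDomain.ofDomain q g)
    incl_emb := fun f => j.extend_eq (e := UniformSpace.Completion.toComplL)
      (UniformSpace.Completion.denseRange_coe (α := q.EnergyDomain))
      (UniformSpace.Completion.isUniformInducing_coe q.EnergyDomain) (EnergyDomain.ofDomain q f) }

theorem mem_graph_toOperator {q : NonnegForm H} (hq : Dense (q.domain : Set H)) (x y : H) :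
    (x, y) ∈ q.toOperator.graph ↔
      ∃ hx : x ∈ q.domain, ∀ g : q.domain, q.form g ⟨x, hx⟩ = inner ℂ (g : H) y := by
  rw [toOperator, Submodule.toLinearPMap_graph_eq]
  · rfl
  · rintro ⟨x, y⟩ ⟨hx, h⟩ (rfl : x = 0)
    refine hq.eq_zero_of_inner_right ℂ fun g hg => ?_
    rw [← h ⟨g, hg⟩]
    exact map_zero (q.form ⟨g, hg⟩)

namespace Model

variable {q : NonnegForm H} {K : Type*} [NormedAddCommGroup K] [InnerProductSpace ℂ K]

theorem quad_eq (m : q.Model K) (f : q.domain) : q.quad f = ‖m.emb f‖ ^ 2 := by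
  rw [quad, ← m.inner_emb, ← inner_self_eq_norm_sq (𝕜 := ℂ)]
  rfl

theorem approx_of_tendsto (m : q.Model K) {u : ℕ → q.domain} {k : K}
    (h : Tendsto (fun n => m.emb (u n)) atTop (𝓝 k)) : q.Approx u (m.incl k) := by
  constructor
  · simpa only [Function.comp_def, m.incl_emb] using (m.incl.continuous.tendsto k).comp h
  · simp only [m.quad_eq, map_sub, ← dist_eq_norm]
    simpa using (cauchySeq_iff_tendsto_dist_atTop_0.1 h.cauchySeq).pow 2

theorem exists_tendsto_of_approx [CompleteSpace K] (m : q.Model K) {u : ℕ → q.domain} {f : H}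
    (h : q.Approx u f) : ∃ k, Tendsto (fun n => m.emb (u n)) atTop (𝓝 k) ∧ m.incl k = f := by
  have hc : CauchySeq fun n => m.emb (u n) := by
    rw [cauchySeq_iff_tendsto_dist_atTop_0]
    have h2 := h.2.sqrt
    simp only [m.quad_eq, map_sub, ← dist_eq_norm, Real.sqrt_zero, Real.sqrt_sq dist_nonneg] at h2
    exact h2
  obtain ⟨k, hk⟩ := cauchySeq_tendsto_of_complete hc
  exact ⟨k, hk, tendsto_nhds_unique (m.approx_of_tendsto hk).1 h.1⟩

theorem exists_seq_tendsto (m : q.Model K) (k : K) :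
    ∃ u : ℕ → q.domain, Tendsto (fun n => m.emb (u n)) atTop (𝓝 k) := by
  obtain ⟨x, hx, hk⟩ := mem_closure_iff_seq_limit.1 (m.denseRange_emb k)
  choose u hu using hx
  exact ⟨u, by simpa only [hu] using hk⟩

theorem mem_closureDomain [CompleteSpace K] (m : q.Model K) (f : H) :
    f ∈ q.closureDomain ↔ ∃ k, m.incl k = f := by
  constructor
  · rintro ⟨u, hu⟩
    obtain ⟨k, -, hk⟩ := m.exists_tendsto_of_approx hu
    exact ⟨k, hk⟩
  · rintro ⟨k, rfl⟩
    obtain ⟨u, hu⟩ := m.exists_seq_tendsto k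
    exact ⟨u, m.approx_of_tendsto hu⟩

/-- If `u n → 0` in `H` and is Cauchy for the form, its limit in `K` is killed by `incl`;
injectivity makes that limit zero. -/
theorem isClosable [CompleteSpace K] (m : q.Model K) (h : Function.Injective m.incl) :
    q.IsClosable := by
  intro u hu hu'
  obtain ⟨k, hk, hk0⟩ := m.exists_tendsto_of_approx ⟨tendsto_zero_iff_norm_tendsto_zero.2 hu, hu'⟩
  obtain rfl : k = 0 := h (hk0.trans (map_zero _).symm)
  simpa [m.quad_eq] using (hk.norm).pow 2

theorem closureVal_eq (m : q.Model K) (hq : q.IsClosable) {f g : q.closureDomain}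
    {k l : K} (hk : m.incl k = f) (hl : m.incl l = g) : q.closureVal f g = inner ℂ k l := by
  obtain ⟨u, hu⟩ := m.exists_seq_tendsto k
  obtain ⟨v, hv⟩ := m.exists_seq_tendsto l
  refine tendsto_nhds_unique (q.tendsto_closureVal hq f g (hk ▸ m.approx_of_tendsto hu)
    (hl ▸ m.approx_of_tendsto hv)) ?_
  simpa only [m.inner_emb] using hu.inner (𝕜 := ℂ) hv

/-- On `ran incl` the closed form is the inner product of `K`. For `x = incl k`, the condition `⟪l,
k⟫ = ⟪incl l, y⟫` for all `l` says `k = incl† y`. -/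
theorem mem_graph_toOperator_closure [CompleteSpace H] [CompleteSpace K] (m : q.Model K)
    (hd : Dense (q.domain : Set H)) (hq : q.IsClosable) (x y : H) :
    (x, y) ∈ (q.closure hq).toOperator.graph ↔ m.incl (m.incl.adjoint y) = x := by
  have hle : q.domain ≤ q.closureDomain := fun f hf => ⟨_, q.approx_const ⟨f, hf⟩⟩
  rw [mem_graph_toOperator (q := q.closure hq) (hd.mono hle)]
  constructor
  · rintro ⟨hx, h⟩
    obtain ⟨k, rfl⟩ := (m.mem_closureDomain x).1 hx
    congr 1
    refine ext_inner_left ℂ fun l => ?_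
    rw [ContinuousLinearMap.adjoint_inner_right]
    have h1 := h ⟨m.incl l, (m.mem_closureDomain _).2 ⟨l, rfl⟩⟩
    rw [← h1]
    exact m.closureVal_eq hq rfl rfl
  · rintro rfl
    refine ⟨(m.mem_closureDomain _).2 ⟨_, rfl⟩, fun ⟨g, hg⟩ => ?_⟩
    obtain ⟨l, rfl⟩ := (m.mem_closureDomain g).1 hg
    refine (m.closureVal_eq hq (k := l) rfl rfl).trans ?_
    rw [ContinuousLinearMap.adjoint_inner_right]

end Model

end NonnegForm

namespace LinearPMap

variable {H : Type*} [NormedAddCommGroup H] [InnerProductSpace ℂ H]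

/-- A strictly positive symmetric operator is bounded below, as a form. -/
theorem IsStrictlyPositiveSymmetric.exists_le_quad_symmForm {S : H →ₗ.[ℂ] H}
    (hS : S.IsStrictlyPositiveSymmetric) :
    ∃ ε : ℝ, 0 < ε ∧ ∀ f : S.domain, ε * ‖(f : H)‖ ^ 2 ≤ (S.symmForm hS).quad f :=
  hS.2.2

variable [CompleteSpace H]

/-! ### Compression of a positive operator to a subspace. -/

section Compression

variable {G : H →L[ℂ] H} (V : Submodule ℂ H)

theorem mem_graph_pinv_of_ker_eq_bot (hG : G.IsPositive) (hker : G.ker = ⊥) (x y : H) :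
    (x, y) ∈ (pinv G).graph ↔ G y = x := by
  rw [mem_graph_pinv hG, hker]
  simp only [Submodule.bot_orthogonal_eq_top, Submodule.mem_top, true_and, Submodule.mem_bot,
    sub_eq_zero]
  exact eq_comm

theorem norm_sqrt_apply_sq (hG : G.IsPositive) (x : H) :
    (‖CFC.sqrt G x‖ ^ 2 : ℝ) = (inner ℂ x (G x)).re := by
  rw [← hG.sqrt_apply_sqrt_apply,
    ← (ContinuousLinearMap.IsPositive.isPositive_sqrt G).inner_left_eq_inner_right,
    ← inner_self_eq_norm_sq (𝕜 := ℂ)]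
  rfl

variable [V.HasOrthogonalProjection]

theorem inner_starProjection_comp (G : H →L[ℂ] H) (x : H) :
    inner ℂ x ((V.starProjection ∘L G ∘L V.starProjection) x) =
      inner ℂ (V.starProjection x) (G (V.starProjection x)) := by
  simp only [ContinuousLinearMap.comp_apply]
  rw [V.inner_starProjection_left_eq_right]

/-- If the compression kills `x`, then `‖√G (P x)‖² = ⟪P x, G P x⟫ = 0`, and `√G` is injective. -/
theorem ker_starProjection_comp (hG : G.IsPositive) (hker : G.ker = ⊥) :
    (V.starProjection ∘L G ∘L V.starProjection).ker = Vᗮ := by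
  ext x
  constructor
  · intro hx
    have h1 := inner_starProjection_comp V G x
    rw [show (V.starProjection ∘L G ∘L V.starProjection) x = 0 from hx, inner_zero_right] at h1
    have h2 := norm_sqrt_apply_sq hG (V.starProjection x)
    rw [← h1, Complex.zero_re, sq_eq_zero_iff, norm_eq_zero] at h2
    have h3 : V.starProjection x ∈ (CFC.sqrt G).ker := h2
    rw [hG.ker_sqrt, hker, Submodule.mem_bot] at h3
    exact (V.starProjection_apply_eq_zero_iff).1 h3
  · intro hx
    change V.starProjection (G (V.starProjection x)) = 0
    rw [(V.starProjection_apply_eq_zero_iff).2 hx, _root_.map_zero, _root_.map_zero]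

theorem adjoint_starProjection_comp_sqrt (G : H →L[ℂ] H) :
    (V.starProjection ∘L CFC.sqrt G).adjoint = CFC.sqrt G ∘L V.starProjection := by
  rw [ContinuousLinearMap.adjoint_comp,
    (ContinuousLinearMap.isSelfAdjoint_iff'.1
      (ContinuousLinearMap.IsPositive.isPositive_sqrt G).isSelfAdjoint),
    (ContinuousLinearMap.isSelfAdjoint_iff'.1 (isSelfAdjoint_starProjection V))]

/-- The form domain of the compression of `G` to `V`, inverted and extended by zero, is
`ran √G + Vᗮ`. -/
theorem mem_domain_pinv_sqrt_compression (hG : G.IsPositive) (hker : G.ker = ⊥) (x : H) :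
    x ∈ (pinv (CFC.sqrt (V.starProjection ∘L G ∘L V.starProjection))).domain ↔
      ∃ w, x - CFC.sqrt G w ∈ Vᗮ := by
  have hC : (V.starProjection ∘L G ∘L V.starProjection).IsPositive := hG.conj_starProjection V
  have hM := ContinuousLinearMap.IsPositive.isPositive_sqrt
    (V.starProjection ∘L G ∘L V.starProjection)
  rw [mem_domain_pinv hM, hC.ker_sqrt, ker_starProjection_comp V hG hker]
  -- Both squares equal `⟪P y, G P y⟫`. Equal norms of adjoints mean equal ranges, by the range
  -- lemma used in both directions below.
  have hnorm (y : H) : ‖(CFC.sqrt (V.starProjection ∘L G ∘L V.starProjection)).adjoint y‖ =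
      ‖(V.starProjection ∘L CFC.sqrt G).adjoint y‖ := by
    rw [adjoint_starProjection_comp_sqrt, ContinuousLinearMap.isSelfAdjoint_iff'.1 hM.isSelfAdjoint]
    rw [← sq_eq_sq₀ (norm_nonneg _) (norm_nonneg _), norm_sqrt_apply_sq hC,
      inner_starProjection_comp, ContinuousLinearMap.comp_apply, norm_sqrt_apply_sq hG]
  have hsub (w : H) : x - CFC.sqrt G w ∈ Vᗮ ↔ x - V.starProjection (CFC.sqrt G w) ∈ Vᗮ := by
    rw [← Submodule.add_mem_iff_right (x := CFC.sqrt G w - V.starProjection (CFC.sqrt G w)) _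
      (V.sub_starProjection_mem_orthogonal _), sub_add_sub_comm,
      add_comm (CFC.sqrt G w), add_sub_add_right_eq_sub]
  simp only [hsub]
  constructor
  · rintro ⟨y, hy⟩
    obtain ⟨w, hw⟩ := ContinuousLinearMap.exists_apply_eq_of_norm_adjoint_le _
      (V.starProjection ∘L CFC.sqrt G) (fun z => (hnorm z).le) y
    exact ⟨w, by rwa [← hw] at hy⟩
  · rintro ⟨w, hw⟩
    obtain ⟨y, hy⟩ := ContinuousLinearMap.exists_apply_eq_of_norm_adjoint_le
      (V.starProjection ∘L CFC.sqrt G) _ (fun z => (hnorm z).ge) w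
    exact ⟨y, by rwa [hy]⟩

end Compression

/-! ### Friedrichs and Kreĭn–von Neumann extensions as inverses. -/

section Extensions

variable {S : H →ₗ.[ℂ] H} {hS : S.IsStrictlyPositiveSymmetric} {K : Type*} [NormedAddCommGroup K]
  [InnerProductSpace ℂ K] [CompleteSpace K] (m : (S.symmForm hS).Model K)

theorem mem_graph_adjoint_iff_forall_domain (hS : Dense (S.domain : Set H)) (x y : H) :
    (x, y) ∈ S.adjoint.graph ↔ ∀ f : S.domain, inner ℂ (S f) x = inner ℂ (f : H) y := by
  rw [mem_graph_adjoint hS]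
  constructor
  · exact fun h f => h _ _ (S.mem_graph f)
  · intro h a b hab
    obtain ⟨f, rfl, rfl⟩ := (mem_graph_iff _).1 hab
    exact h f

/-- The closure of the range of an operator. -/
def rangeClosure (S : H →ₗ.[ℂ] H) : Submodule ℂ H := (LinearMap.range S.toFun).topologicalClosure

instance (S : H →ₗ.[ℂ] H) : CompleteSpace S.rangeClosure :=
  inferInstanceAs (CompleteSpace (LinearMap.range S.toFun).topologicalClosure)

theorem mem_orthogonal_rangeClosure (x : H) :
    x ∈ S.rangeClosureᗮ ↔ ∀ f : S.domain, inner ℂ (S f) x = 0 := by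
  rw [rangeClosure, Submodule.orthogonal_closure, Submodule.mem_orthogonal]
  constructor
  · exact fun h f => h _ ⟨f, rfl⟩
  · rintro h _ ⟨f, rfl⟩
    exact h f

theorem kernel_adjoint (hS : Dense (S.domain : Set H)) : S.adjoint.kernel = S.rangeClosureᗮ := by
  ext x
  rw [mem_kernel, mem_graph_adjoint_iff_forall_domain hS, mem_orthogonal_rangeClosure]
  simp

theorem closed_induction_rangeClosure {p : H → Prop} (hp : _root_.IsClosed {x | p x})
    (h : ∀ f : S.domain, p (S f)) {y : H} (hy : y ∈ S.rangeClosure) : p y := by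
  refine closure_minimal (s := (LinearMap.range S.toFun : Set H)) (t := {x | p x}) ?_ hp hy
  rintro _ ⟨f, rfl⟩
  exact h f

/-- The embedding of the domain of `S` in a model of its form. -/
def energyEmb : S.domain →ₗ[ℂ] K := m.emb

theorem denseRange_energyEmb : DenseRange (energyEmb m) := m.denseRange_emb

theorem inner_energyEmb (f g : S.domain) :
    inner ℂ (energyEmb m f) (energyEmb m g) = inner ℂ (f : H) (S g) := m.inner_emb f g

theorem incl_energyEmb (f : S.domain) : m.incl (energyEmb m f) = f := m.incl_emb f

/-- The bounded inverse of the Friedrichs extension. -/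
def energyInv : H →L[ℂ] H := m.incl ∘L m.incl.adjoint

theorem isPositive_energyInv : (energyInv m).IsPositive :=
  ContinuousLinearMap.isPositive_self_comp_adjoint _

theorem adjoint_incl_apply (f : S.domain) : m.incl.adjoint (S f) = energyEmb m f := by
  refine (denseRange_energyEmb m).eq_of_inner_right ℂ ?_
  intro g
  rw [ContinuousLinearMap.adjoint_inner_right, inner_energyEmb, incl_energyEmb m]

theorem energyInv_apply (f : S.domain) : energyInv m (S f) = f := by
  change m.incl (m.incl.adjoint (S f)) = f
  rw [adjoint_incl_apply, incl_energyEmb m]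

/-- `⟪incl k, S f⟫ = ⟪k, incl† (S f)⟫`, and the vectors `incl† (S f)` are the dense copy of `D(S)`
in `K`. This gives injectivity of `incl` and also the directness of the sum with `ker S*`. -/
theorem eq_zero_of_incl_mem_orthogonal {k : K} (hk : m.incl k ∈ S.rangeClosureᗮ) : k = 0 := by
  refine (denseRange_energyEmb m).eq_zero_of_inner_right ℂ ?_
  intro f
  rw [← adjoint_incl_apply, ContinuousLinearMap.adjoint_inner_left]
  exact (mem_orthogonal_rangeClosure _).1 hk f

theorem incl_injective : Function.Injective m.incl := by
  rw [injective_iff_map_eq_zero]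
  intro k hk
  exact eq_zero_of_incl_mem_orthogonal m (hk ▸ zero_mem _)

theorem ker_energyInv : (energyInv m).ker = ⊥ := by
  rw [Submodule.eq_bot_iff]
  intro x hx
  have h1 : m.incl.adjoint x = 0 := incl_injective m (hx.trans (_root_.map_zero _).symm)
  refine hS.1.eq_zero_of_inner_left ℂ fun f hf => ?_
  rw [← show m.incl (energyEmb m ⟨f, hf⟩) = f from incl_energyEmb m ⟨f, hf⟩, ← ContinuousLinearMap.adjoint_inner_left, h1,
    inner_zero_left]

theorem mem_graph_pinv_energyInv (x y : H) :
    (x, y) ∈ (pinv (energyInv m)).graph ↔ energyInv m y = x :=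
  mem_graph_pinv_of_ker_eq_bot (isPositive_energyInv m) (ker_energyInv m) x y

theorem energyInv_mem_graph_adjoint (y : H) : (energyInv m y, y) ∈ S.adjoint.graph := by
  rw [mem_graph_adjoint_iff_forall_domain hS.1]
  intro f
  rw [← (isPositive_energyInv m).inner_left_eq_inner_right, energyInv_apply]

/-- For `x = incl k`, both sides of `⟪S f, x⟫ = ⟪f, y⟫` are pairings in `K` with the copy of `f`:
the left with `k`, the right with `incl† y`. Density gives `k = incl† y`. -/
theorem friedrichs_eq_pinv : S.friedrichs hS = pinv (energyInv m) := by
  refine eq_of_eq_graph (Submodule.ext fun ⟨x, y⟩ => ?_)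
  rw [friedrichs, mem_graph_domRestrict, mem_graph_pinv_energyInv, m.mem_closureDomain]
  constructor
  · rintro ⟨⟨k, rfl⟩, h⟩
    change m.incl (m.incl.adjoint y) = m.incl k
    congr 1
    refine (denseRange_energyEmb m).eq_of_inner_right ℂ ?_
    intro f
    rw [ContinuousLinearMap.adjoint_inner_right, incl_energyEmb m, ← adjoint_incl_apply,
      ContinuousLinearMap.adjoint_inner_left]
    exact ((mem_graph_adjoint_iff_forall_domain hS.1 _ _).1 h f).symm
  · rintro rfl
    exact ⟨⟨_, rfl⟩, energyInv_mem_graph_adjoint m y⟩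

theorem le_friedrichs : S ≤ pinv (energyInv m) := by
  refine le_of_le_graph fun ⟨x, y⟩ hxy => ?_
  obtain ⟨f, rfl, rfl⟩ := (mem_graph_iff _).1 hxy
  exact (mem_graph_pinv_energyInv m _ _).2 (energyInv_apply m f)

theorem mul_norm_incl_sq_le {ε : ℝ}
    (h : ∀ f : S.domain, ε * ‖(f : H)‖ ^ 2 ≤ (S.symmForm hS).quad f) (k : K) :
    ε * ‖m.incl k‖ ^ 2 ≤ ‖k‖ ^ 2 := by
  refine (denseRange_energyEmb m).induction_on (p := fun k => ε * ‖m.incl k‖ ^ 2 ≤ ‖k‖ ^ 2) k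
    (isClosed_le (by fun_prop) (by fun_prop)) fun f => ?_
  rw [incl_energyEmb]
  exact (h f).trans_eq (m.quad_eq f)

theorem isStrictlyPositiveSymmetric_pinv_energyInv :
    (pinv (energyInv m)).IsStrictlyPositiveSymmetric := by
  have hsa := isSelfAdjoint_pinv (isPositive_energyInv m)
  obtain ⟨ε, hε, h⟩ := hS.exists_le_quad_symmForm
  refine ⟨hsa.dense_domain, ?_, ε, hε, fun f => ?_⟩
  · exact fun x y => (hsa.mem_graph_iff _ _).1 (mem_graph _ y) _ _ (mem_graph _ x)
  · have h1 : m.incl (m.incl.adjoint (pinv (energyInv m) f)) = f :=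
      (mem_graph_pinv_energyInv m _ _).1 (mem_graph _ f)
    -- For `y = S_F f` one has `f = incl (incl† y)` and `⟪f, y⟫ = ‖incl† y‖²`, so the bound for
    -- `incl` is the lower bound for `S_F`.
    have h2 := mul_norm_incl_sq_le m h (m.incl.adjoint (pinv (energyInv m) f))
    rw [h1] at h2
    refine h2.trans_eq ?_
    rw [← inner_self_eq_norm_sq (𝕜 := ℂ), ContinuousLinearMap.adjoint_inner_right, h1]
    rfl

theorem isClosable_of_isStrictlyPositiveSymmetric (hS : S.IsStrictlyPositiveSymmetric) :
    S.IsClosable :=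
  (adjoint_isClosed hS.1).isClosable.leIsClosable (hS.2.1.le_adjoint hS.1)

/-- The graph of `S` is `{(G y, y) : y ∈ ran S}`, and `G` is continuous, so closing the graph only
closes the set of admissible `y`. -/
theorem mem_graph_closure (x y : H) :
    (x, y) ∈ S.closure.graph ↔ y ∈ S.rangeClosure ∧ energyInv m y = x := by
  rw [← (isClosable_of_isStrictlyPositiveSymmetric hS).graph_closure_eq_closure_graph]
  constructor
  · intro h
    have hc : _root_.IsClosed {p : H × H | p.2 ∈ S.rangeClosure ∧ energyInv m p.2 = p.1} :=
      ((Submodule.isClosed_topologicalClosure _).preimage continuous_snd).inter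
        (isClosed_eq (by fun_prop) (by fun_prop))
    refine closure_minimal (s := (S.graph : Set (H × H))) ?_ hc h
    rintro ⟨a, b⟩ hab
    obtain ⟨f, rfl, rfl⟩ := (mem_graph_iff _).1 hab
    exact ⟨Submodule.le_topologicalClosure _ ⟨f, rfl⟩, energyInv_apply m f⟩
  · rintro ⟨hy, rfl⟩
    refine closed_induction_rangeClosure (S := S)
      (p := fun y => (energyInv m y, y) ∈ S.graph.topologicalClosure) ?_ ?_ hy
    · exact (Submodule.isClosed_topologicalClosure S.graph).preimage
        (f := fun y => (energyInv m y, y)) (by fun_prop)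
    · intro f
      rw [energyInv_apply]
      exact Submodule.le_topologicalClosure _ (S.mem_graph f)

/-- Elements of `D(S_K)` are `G y + n` with `y ∈ R` and `n ∈ Rᗮ`, mapped to `y`. Since `G y - P G P
y ∈ Rᗮ = ker (P G P)`, this is the inverse of `P G P` extended by zero. -/
theorem krein_eq_pinv : S.krein =
    pinv (S.rangeClosure.starProjection ∘L energyInv m ∘L S.rangeClosure.starProjection) := by
  have hG := isPositive_energyInv m
  have hd := hS.1
  refine eq_of_eq_graph (Submodule.ext fun ⟨x, y⟩ => ?_)
  rw [mem_graph_pinv (hG.conj_starProjection _),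
    ker_starProjection_comp _ hG (ker_energyInv m), Submodule.orthogonal_orthogonal, krein,
    mem_graph_domRestrict, Submodule.mem_sup]
  have hproj {w : H} (hw : w ∈ S.rangeClosure) :
      x - (S.rangeClosure.starProjection ∘L energyInv m ∘L S.rangeClosure.starProjection) w ∈
        S.rangeClosureᗮ ↔ x - energyInv m w ∈ S.rangeClosureᗮ := by
    simp only [ContinuousLinearMap.comp_apply, Submodule.starProjection_eq_self_iff.2 hw]
    rw [← Submodule.add_mem_iff_right (x := energyInv m w -
      S.rangeClosure.starProjection (energyInv m w)) (y := x - energyInv m w) _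
      (Submodule.sub_starProjection_mem_orthogonal _), add_comm, sub_add_sub_cancel]
  constructor
  · rintro ⟨⟨f, hf, n, hn, rfl⟩, hxy⟩
    obtain ⟨w, hw⟩ := mem_domain_iff.1 hf
    obtain ⟨hwr, rfl⟩ := (mem_graph_closure m _ _).1 hw
    have h1 := add_mem (energyInv_mem_graph_adjoint m w) ((mem_kernel _ _).1 hn)
    -- `S*` is single-valued and sends `G w + n` both to `w + 0` and to `y`.
    have h2 : w = y := mem_graph_snd_inj _ h1 hxy (by simp) |>.symm ▸ by simp
    subst h2
    refine ⟨hwr, (hproj hwr).2 ?_⟩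
    rw [← kernel_adjoint hd]
    simpa using hn
  · rintro ⟨hy, hxy⟩
    have hn : x - energyInv m y ∈ S.adjoint.kernel := by
      rw [kernel_adjoint hd]
      exact (hproj hy).1 hxy
    refine ⟨⟨energyInv m y, mem_domain_of_mem_graph ((mem_graph_closure m _ _).2 ⟨hy, rfl⟩),
      x - energyInv m y, hn, by abel⟩, ?_⟩
    simpa using add_mem (energyInv_mem_graph_adjoint m y) ((mem_kernel _ _).1 hn)

end Extensions

end LinearPMap

/-! ### The dissipative operator `i S`, its imaginary part and `W_A`. -/

namespace LinearPMap

variable {H : Type*} [NormedAddCommGroup H] [InnerProductSpace ℂ H] {S : H →ₗ.[ℂ] H}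

theorem IsStrictlyPositiveSymmetric.isDissipative_I_smul (hS : S.IsStrictlyPositiveSymmetric) :
    (Complex.I • S).IsDissipative := by
  obtain ⟨ε, hε, h⟩ := hS.2.2
  refine ⟨hS.1, fun f => ?_⟩
  rw [smul_apply, inner_smul_right, Complex.I_mul_im]
  exact le_trans (by positivity) (h f)

theorem imForm_I_smul_apply (hS : S.IsStrictlyPositiveSymmetric)
    (hA : (Complex.I • S).IsDissipative) (f g : S.domain) :
    ((Complex.I • S).imForm hA).form f g = inner ℂ (f : H) (S g) := by
  change (inner ℂ (f : H) (Complex.I • S g) - inner ℂ (Complex.I • S f) (g : H)) /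
    (2 * Complex.I) = _
  rw [inner_smul_right, inner_smul_left, hS.2.1 f g, Complex.conj_I]
  field_simp
  ring

variable {hS : S.IsStrictlyPositiveSymmetric} {K : Type*} [NormedAddCommGroup K]
  [InnerProductSpace ℂ K] (m : (S.symmForm hS).Model K)

/-- The form of `S` and the imaginary part of `i S` have the same models. -/
def imFormModel (hA : (Complex.I • S).IsDissipative) : ((Complex.I • S).imForm hA).Model K where
  emb := m.emb
  incl := m.incl
  denseRange_emb := m.denseRange_emb
  inner_emb f g := (m.inner_emb f g).trans (imForm_I_smul_apply hS hA f g).symm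
  incl_emb := m.incl_emb

variable [CompleteSpace H] [CompleteSpace K]

theorem isClosable_imForm_I_smul (m : (S.symmForm hS).Model K)
    (hA : (Complex.I • S).IsDissipative) :
    ((Complex.I • S).imForm hA).IsClosable :=
  (imFormModel m hA).isClosable (incl_injective m)

theorem imPart_I_smul_eq_pinv (hA : (Complex.I • S).IsDissipative)
    (hq : ((Complex.I • S).imForm hA).IsClosable) :
    (Complex.I • S).imPart hA hq = pinv (energyInv m) := by
  refine eq_of_eq_graph (Submodule.ext fun ⟨x, y⟩ => ?_)
  rw [imPart, (imFormModel m hA).mem_graph_toOperator_closure hA.1, mem_graph_pinv_energyInv]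
  rfl

/-- The inverse of the square root of the Friedrichs extension. -/
def energyInvSqrt : H →L[ℂ] H := CFC.sqrt (energyInv m)

theorem isPositive_energyInvSqrt : (energyInvSqrt m).IsPositive :=
  ContinuousLinearMap.IsPositive.isPositive_sqrt _

theorem ker_energyInvSqrt : (energyInvSqrt m).ker = ⊥ := by
  rw [energyInvSqrt, (isPositive_energyInv m).ker_sqrt, ker_energyInv]

theorem energyInvSqrt_energyInvSqrt (x : H) :
    energyInvSqrt m (energyInvSqrt m x) = energyInv m x :=
  (isPositive_energyInv m).sqrt_apply_sqrt_apply x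

theorem mem_graph_pinv_energyInvSqrt (x y : H) :
    (x, y) ∈ (pinv (energyInvSqrt m)).graph ↔ energyInvSqrt m y = x :=
  mem_graph_pinv_of_ker_eq_bot (isPositive_energyInvSqrt m) (ker_energyInvSqrt m) x y

theorem mem_domain_pinv_energyInvSqrt (x : H) :
    x ∈ (pinv (energyInvSqrt m)).domain ↔ ∃ y, energyInvSqrt m y = x := by
  simp only [mem_domain_iff, mem_graph_pinv_energyInvSqrt]

theorem energyInvSqrt_injective : Function.Injective (energyInvSqrt m) :=
  LinearMap.ker_eq_bot.1 (ker_energyInvSqrt m)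

/-- `‖√G z‖ = ‖incl† z‖` places `ran √G` inside `ran incl`, which meets `Rᗮ` only in zero. -/
theorem disjoint_domain_pinv_energyInvSqrt :
    Disjoint (pinv (energyInvSqrt m)).domain S.rangeClosureᗮ := by
  rw [Submodule.disjoint_def]
  intro x hx hx'
  obtain ⟨y, rfl⟩ := (mem_domain_pinv_energyInvSqrt m x).1 hx
  obtain ⟨k, hk⟩ := ContinuousLinearMap.exists_apply_eq_of_norm_adjoint_le (energyInvSqrt m) m.incl
    (fun z => by
      rw [ContinuousLinearMap.isSelfAdjoint_iff'.1 (isPositive_energyInvSqrt m).isSelfAdjoint]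
      refine ((sq_eq_sq₀ (norm_nonneg _) (norm_nonneg _)).1 ?_).le
      rw [energyInvSqrt, norm_sqrt_apply_sq (isPositive_energyInv m),
        ← inner_self_eq_norm_sq (𝕜 := ℂ), ContinuousLinearMap.adjoint_inner_left]
      rfl) y
  rw [← hk] at hx' ⊢
  rw [eq_zero_of_incl_mem_orthogonal m hx', _root_.map_zero]

theorem mem_domain_sup_rangeClosure_orthogonal (x : H) :
    x ∈ (pinv (energyInvSqrt m)).domain ⊔ S.rangeClosureᗮ ↔
      ∃ w, x - energyInvSqrt m w ∈ S.rangeClosureᗮ := by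
  rw [Submodule.mem_sup]
  constructor
  · rintro ⟨a, ha, n, hn, rfl⟩
    obtain ⟨w, rfl⟩ := (mem_domain_pinv_energyInvSqrt m a).1 ha
    exact ⟨w, by simpa using hn⟩
  · rintro ⟨w, hw⟩
    exact ⟨_, (mem_domain_pinv_energyInvSqrt m _).2 ⟨w, rfl⟩, _, hw, by abel⟩

theorem mem_domain_sqrtOp_krein (x : H) :
    x ∈ S.krein.sqrtOp.domain ↔ ∃ w, x - energyInvSqrt m w ∈ S.rangeClosureᗮ := by
  have hG := isPositive_energyInv m
  rw [krein_eq_pinv m, sqrtOp_pinv (hG.conj_starProjection _)]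
  exact mem_domain_pinv_sqrt_compression _ hG (ker_energyInv m) x

/-- From `f = √G √G S f` one gets `V_A^{1/2} f = √G S f`, so `W_A` sends `√G S f` to `i S f`. -/
theorem mem_graph_wOp (hA : (Complex.I • S).IsDissipative)
    (hq : ((Complex.I • S).imForm hA).IsClosable) (x y : H) :
    (x, y) ∈ ((Complex.I • S).wOp hA hq).graph ↔
      ∃ f : S.domain, energyInvSqrt m (S f) = x ∧ Complex.I • S f = y := by
  rw [wOp, imPart_I_smul_eq_pinv m hA hq, sqrtOp_pinv (isPositive_energyInv m), mem_graph_mulOp]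
  change (∃ z, (x, z) ∈ ((pinv (energyInvSqrt m)).domRestrict S.domain).inverse.graph ∧ _) ↔ _
  have hinv (a b : H) : (a, b) ∈ ((pinv (energyInvSqrt m)).domRestrict S.domain).inverse.graph ↔
      b ∈ S.domain ∧ energyInvSqrt m a = b := by
    rw [mem_graph_inverse, mem_graph_domRestrict, mem_graph_pinv_energyInvSqrt]
    intro c hc
    rw [mem_graph_domRestrict, mem_graph_pinv_energyInvSqrt, _root_.map_zero] at hc
    exact hc.2.symm
  have hsqrt (f : S.domain) : energyInvSqrt m (energyInvSqrt m (S f)) = f := by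
    rw [energyInvSqrt_energyInvSqrt, energyInv_apply]
  simp only [hinv, mem_graph_smul]
  constructor
  · rintro ⟨z, ⟨hz, hxz⟩, w, hw, rfl⟩
    obtain ⟨f, rfl, rfl⟩ := (mem_graph_iff _).1 hw
    exact ⟨f, energyInvSqrt_injective m ((hsqrt f).trans hxz.symm), rfl⟩
  · rintro ⟨f, rfl, rfl⟩
    exact ⟨f, ⟨f.2, hsqrt f⟩, S f, S.mem_graph f, rfl⟩

/-- If `g` is orthogonal to every `√G S f`, then `√G g` lies in `ran √G ∩ Rᗮ = {0}`. -/
theorem dense_domain_wOp (m : (S.symmForm hS).Model K)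
    (hA : (Complex.I • S).IsDissipative)
    (hq : ((Complex.I • S).imForm hA).IsClosable) :
    Dense (((Complex.I • S).wOp hA hq).domain : Set H) := by
  rw [Submodule.dense_iff_topologicalClosure_eq_top, Submodule.topologicalClosure_eq_top_iff,
    Submodule.eq_bot_iff]
  intro g hg
  have h1 : energyInvSqrt m g ∈ S.rangeClosureᗮ := by
    rw [mem_orthogonal_rangeClosure]
    intro f
    rw [← (isPositive_energyInvSqrt m).inner_left_eq_inner_right]
    exact hg _ (mem_domain_of_mem_graph ((mem_graph_wOp m hA hq _ _).2 ⟨f, rfl, rfl⟩))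
  have h2 := Submodule.disjoint_def.1 (disjoint_domain_pinv_energyInvSqrt m) _
    ((mem_domain_pinv_energyInvSqrt m _).2 ⟨g, rfl⟩) h1
  exact energyInvSqrt_injective m (h2.trans (_root_.map_zero _).symm)

theorem mem_graph_adjoint_wOp (hA : (Complex.I • S).IsDissipative)
    (hq : ((Complex.I • S).imForm hA).IsClosable) (x y : H) :
    (x, y) ∈ ((Complex.I • S).wOp hA hq).adjoint.graph ↔
      x - energyInvSqrt m (Complex.I • y) ∈ S.rangeClosureᗮ := by
  rw [mem_graph_adjoint (dense_domain_wOp m hA hq), mem_orthogonal_rangeClosure]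
  have hiff (f : S.domain) : inner ℂ (S f) (x - energyInvSqrt m (Complex.I • y)) = 0 ↔
      inner ℂ (Complex.I • S f) x = inner ℂ (energyInvSqrt m (S f)) y := by
    rw [inner_sub_right, _root_.map_smul, inner_smul_right, inner_smul_left, Complex.conj_I,
      (isPositive_energyInvSqrt m).inner_left_eq_inner_right, sub_eq_zero]
    constructor
    · intro h
      rw [h, ← mul_assoc, neg_mul, Complex.I_mul_I, neg_neg, one_mul]
    · intro h
      rw [← h, ← mul_assoc, mul_neg, Complex.I_mul_I, neg_neg, one_mul]
  simp only [hiff, mem_graph_wOp m hA hq]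
  constructor
  · exact fun h f => h _ _ ⟨f, rfl, rfl⟩
  · rintro h _ _ ⟨f, rfl, rfl⟩
    exact h f

theorem domain_adjoint_wOp (m : (S.symmForm hS).Model K)
    (hA : (Complex.I • S).IsDissipative)
    (hq : ((Complex.I • S).imForm hA).IsClosable) :
    ((Complex.I • S).wOp hA hq).adjoint.domain = S.krein.sqrtOp.domain := by
  ext x
  rw [mem_domain_sqrtOp_krein m, mem_domain_iff]
  simp only [mem_graph_adjoint_wOp m hA hq]
  constructor
  · rintro ⟨y, hy⟩
    exact ⟨_, hy⟩
  · rintro ⟨w, hw⟩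
    refine ⟨-Complex.I • w, ?_⟩
    rwa [smul_smul, mul_neg, Complex.I_mul_I, neg_neg, one_smul]

theorem adjoint_wOp_eq (hA : (Complex.I • S).IsDissipative)
    (hq : ((Complex.I • S).imForm hA).IsClosable) :
    ((Complex.I • S).wOp hA hq).adjoint = (-Complex.I) • (pinv (energyInvSqrt m)).mulOp
      (projAlong (pinv (energyInvSqrt m)).domain S.rangeClosureᗮ) := by
  refine eq_of_eq_graph (Submodule.ext fun ⟨x, y⟩ => ?_)
  simp only [mem_graph_adjoint_wOp m hA hq, mem_graph_smul, mem_graph_mulOp,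
    mem_graph_projAlong (disjoint_domain_pinv_energyInvSqrt m), mem_graph_pinv_energyInvSqrt]
  constructor
  · intro h
    -- The decomposition of `x` has component `√G (i y)` in `ran √G`; applying `S_F^{1/2}` to it
    -- returns `i y`.
    refine ⟨Complex.I • y, ⟨_, ⟨(mem_domain_pinv_energyInvSqrt m _).2 ⟨_, rfl⟩, h⟩, rfl⟩, ?_⟩
    rw [smul_smul, neg_mul, Complex.I_mul_I, neg_neg, one_smul]
  · rintro ⟨w, ⟨z, ⟨-, h⟩, rfl⟩, rfl⟩
    rwa [smul_smul, mul_neg, Complex.I_mul_I, neg_neg, one_smul]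

/-! ### Accretive extensions. -/

/-- Cauchy–Schwarz for the non-negative form `Re ⟪f, B f⟫`, whose sesquilinear version is half the
sum on the left; hence the factor 4. -/
theorem IsAccretive.norm_inner_add_inner_le {B : H →ₗ.[ℂ] H} (hB : B.IsAccretive)
    (f g : B.domain) : ‖inner ℂ (f : H) (B g) + inner ℂ (B f) (g : H)‖ ^ 2 ≤
      4 * (inner ℂ (f : H) (B f)).re * (inner ℂ (g : H) (B g)).re := by
  have hpos (h : B.domain) : 0 ≤ (inner ℂ (h : H) (B h)).re := by
    have := hB.2 h
    rwa [smul_apply, inner_smul_right, Complex.I_mul_im] at this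
  set s := inner ℂ (f : H) (B g) + inner ℂ (B f) (g : H) with hs
  have key (t : ℝ) : 0 ≤ ‖s‖ ^ 2 * (inner ℂ (g : H) (B g)).re * (t * t) + ‖s‖ ^ 2 * t +
      (inner ℂ (f : H) (B f)).re := by
    -- The phase `conj s` turns the cross term into `t ‖s‖²`, leaving a real quadratic polynomial in
    -- `t`.
    have h1 := hpos (f + ((t : ℂ) * conj s) • g)
    rw [map_add, map_smul, Submodule.coe_add, Submodule.coe_smul, inner_add_left, inner_add_right,
      inner_add_right, inner_smul_left, inner_smul_right, inner_smul_left, inner_smul_right,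
      ← inner_conj_symm (g : H) (B f)] at h1
    refine h1.trans_eq ?_
    have h2 : ‖s‖ ^ 2 = s.re * s.re + s.im * s.im := by
      rw [← Complex.normSq_eq_norm_sq, Complex.normSq_apply]
    have h3 : s.re = (inner ℂ (f : H) (B g)).re + (inner ℂ (B f) (g : H)).re := by
      rw [hs, Complex.add_re]
    have h4 : s.im = (inner ℂ (f : H) (B g)).im + (inner ℂ (B f) (g : H)).im := by
      rw [hs, Complex.add_im]
    simp only [Complex.add_re, Complex.mul_re, Complex.mul_im, Complex.conj_re, Complex.conj_im,
      Complex.ofReal_re, Complex.ofReal_im, map_mul, h2]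
    rw [h3, h4]
    ring
  have hd := discrim_le_zero key
  rw [discrim] at hd
  -- A violated bound forces `s ≠ 0`, so the factor `‖s‖²` in the discriminant can be cancelled.
  by_contra! hlt
  have hs0 : 0 < ‖s‖ ^ 2 := lt_of_le_of_lt
    (mul_nonneg (mul_nonneg (by norm_num) (hpos f)) (hpos g)) hlt
  nlinarith [mul_lt_mul_of_pos_left hlt hs0]

theorem IsAccretive.domain_le (hS : S.IsStrictlyPositiveSymmetric) (m : (S.symmForm hS).Model K)
    {B : H →ₗ.[ℂ] H} (hSB : S ≤ B) (hB : B.IsAccretive) :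
    B.domain ≤ S.krein.sqrtOp.domain := by
  intro f hf
  have hM := isPositive_energyInvSqrt m
  have hG (g : S.domain) : (g : H) = energyInvSqrt m (energyInvSqrt m (S g)) := by
    rw [energyInvSqrt_energyInvSqrt, energyInv_apply]
  -- The first term comes from Cauchy–Schwarz applied to `⟪f, S g⟫ + ⟪B f, g⟫`, the second from `⟪B
  -- f, g⟫ = ⟪√G B f, √G S g⟫`.
  set c := √(4 * (inner ℂ f (B ⟨f, hf⟩)).re) + ‖energyInvSqrt m (B ⟨f, hf⟩)‖
  have hran (g : S.domain) : ‖inner ℂ f (S g)‖ ≤ c * ‖energyInvSqrt m (S g)‖ := by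
    have hBg : B ⟨g, hSB.1 g.2⟩ = S g := (hSB.2 rfl).symm
    have h1 := hB.norm_inner_add_inner_le ⟨f, hf⟩ ⟨g, hSB.1 g.2⟩
    simp only [hBg] at h1
    have h2 : (inner ℂ (g : H) (S g)).re = ‖energyInvSqrt m (S g)‖ ^ 2 := by
      nth_rewrite 1 [hG g]
      rw [hM.inner_left_eq_inner_right, ← inner_self_eq_norm_sq (𝕜 := ℂ)]
      rfl
    have h3 : ‖inner ℂ (B ⟨f, hf⟩) (g : H)‖ ≤
        ‖energyInvSqrt m (B ⟨f, hf⟩)‖ * ‖energyInvSqrt m (S g)‖ := by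
      rw [hG g, ← hM.inner_left_eq_inner_right]
      exact norm_inner_le_norm _ _
    rw [h2] at h1
    have h4 := Real.le_sqrt_of_sq_le h1
    rw [Real.sqrt_mul' _ (sq_nonneg _), Real.sqrt_sq (norm_nonneg _)] at h4
    have h5 := norm_sub_le (inner ℂ f (S g) + inner ℂ (B ⟨f, hf⟩) (g : H))
      (inner ℂ (B ⟨f, hf⟩) (g : H))
    rw [add_sub_cancel_right] at h5
    rw [add_mul]
    exact h5.trans (add_le_add h4 h3)
  have hclosure {y : H} (hy : y ∈ S.rangeClosure) : ‖inner ℂ f y‖ ≤ c * ‖energyInvSqrt m y‖ :=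
    closed_induction_rangeClosure (p := fun y => ‖inner ℂ f y‖ ≤ c * ‖energyInvSqrt m y‖)
      (isClosed_le (by fun_prop) (by fun_prop)) hran hy
  -- The bound extends by continuity to `R` only, so the range lemma is applied to `P √G` and `P f`.
  -- The outcome `P f = P √G w` says `f - √G w ∈ Rᗮ`.
  obtain ⟨w, hw⟩ := (S.rangeClosure.starProjection ∘L energyInvSqrt m).mem_range_of_norm_inner_le
    (S.rangeClosure.starProjection f) c fun y => by
      rw [energyInvSqrt, adjoint_starProjection_comp_sqrt,
        Submodule.inner_starProjection_left_eq_right]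
      exact hclosure (Submodule.starProjection_apply_mem _ y)
  refine (mem_domain_sqrtOp_krein m f).2 ⟨w, ?_⟩
  have h1 := S.rangeClosure.sub_starProjection_mem_orthogonal (f - energyInvSqrt m w)
  rwa [_root_.map_sub, ← hw, ContinuousLinearMap.comp_apply, sub_self, sub_zero] at h1

end LinearPMap

end

theorem lemma4p5 {H : Type*} [NormedAddCommGroup H] [InnerProductSpace ℂ H] [CompleteSpace H]
    (S : H →ₗ.[ℂ] H) (hS : S.IsStrictlyPositiveSymmetric) :
    -- the Friedrichs extension is a strictly positive selfadjoint extension of `S`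
    (S ≤ S.friedrichs hS ∧ IsSelfAdjoint (S.friedrichs hS) ∧
      (S.friedrichs hS).IsStrictlyPositiveSymmetric) ∧
    -- the operators denoted `S_F^{1/2}` and `S_K^{1/2}` are indeed the square roots
    (S.friedrichs hS).IsNonnegSqrt (S.friedrichs hS).sqrtOp ∧
    S.krein.IsNonnegSqrt S.krein.sqrtOp ∧
    -- `A = i S` is dissipative with closable `q_A`, and `V_A = S_F`
    (∃ (hA : (Complex.I • S).IsDissipative) (hq : ((Complex.I • S).imForm hA).IsClosable),
      (Complex.I • S).imPart hA hq = S.friedrichs hS ∧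
      -- `W_A` is densely defined, and its adjoint is as claimed
      Dense (((Complex.I • S).wOp hA hq).domain : Set H) ∧
      ((Complex.I • S).wOp hA hq).adjoint.domain = S.krein.sqrtOp.domain ∧
      S.krein.sqrtOp.domain = (S.friedrichs hS).sqrtOp.domain ⊔ S.adjoint.kernel ∧
      Disjoint (S.friedrichs hS).sqrtOp.domain S.adjoint.kernel ∧
      ((Complex.I • S).wOp hA hq).adjoint = (-Complex.I) • (S.friedrichs hS).sqrtOp.mulOp
        (LinearPMap.projAlong (S.friedrichs hS).sqrtOp.domain S.adjoint.kernel)) ∧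
    -- every accretive extension of `S` has its domain inside `D(S_K^{1/2})`
    ∀ B : H →ₗ.[ℂ] H, S ≤ B → B.IsAccretive → B.domain ≤ S.krein.sqrtOp.domain := by
  obtain ⟨ε, hε, h⟩ := hS.exists_le_quad_symmForm
  let m := (S.symmForm hS).completionModel hε h
  have hG := LinearPMap.isPositive_energyInv m
  have hC := hG.conj_starProjection S.rangeClosure
  have hF := LinearPMap.friedrichs_eq_pinv m
  have hFs : (S.friedrichs hS).sqrtOp = LinearPMap.pinv (LinearPMap.energyInvSqrt m) := by
    rw [hF, LinearPMap.sqrtOp_pinv hG]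
    rfl
  have hA := hS.isDissipative_I_smul
  have hq := LinearPMap.isClosable_imForm_I_smul m hA
  refine ⟨?_, ?_, ?_, ⟨hA, hq, ?_, LinearPMap.dense_domain_wOp m hA hq,
    LinearPMap.domain_adjoint_wOp m hA hq, ?_, ?_, ?_⟩,
    fun B hSB hB => hB.domain_le hS m hSB⟩
  · rw [hF]
    exact ⟨LinearPMap.le_friedrichs m, LinearPMap.isSelfAdjoint_pinv hG,
      LinearPMap.isStrictlyPositiveSymmetric_pinv_energyInv m⟩
  · rw [hF, LinearPMap.sqrtOp_pinv hG]
    exact LinearPMap.isNonnegSqrt_pinv_sqrt hG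
  · rw [LinearPMap.krein_eq_pinv m, LinearPMap.sqrtOp_pinv hC]
    exact LinearPMap.isNonnegSqrt_pinv_sqrt hC
  · rw [hF, LinearPMap.imPart_I_smul_eq_pinv m]
  · ext x
    rw [hFs, LinearPMap.kernel_adjoint hS.1, LinearPMap.mem_domain_sqrtOp_krein m,
      LinearPMap.mem_domain_sup_rangeClosure_orthogonal]
  · rw [hFs, LinearPMap.kernel_adjoint hS.1]
    exact LinearPMap.disjoint_domain_pinv_energyInvSqrt m
  · rw [hFs, LinearPMap.kernel_adjoint hS.1]
    exact LinearPMap.adjoint_wOp_eq m hA hq
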